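/- Let $R$ be a quadriculated planar region, i.e. a finite union of unit squares of the grid $\mathbb{Z}^2$ (not necessarily simply connected), with squares coloured black and white as a checkerboard. A domino is a union of two unit squares with a common side. Let $T$ be the graph whose vertices are the domino tilings of $R$, two tilings being adjacent iff they differ by a flip (two dominoes forming a $2\times 2$ square are lifted and placed back rotated by $90^\circ$); let $d$ be its graph distance. Let $\mathcal{T}$ be the cube complex obtained from $T$ by gluing a $k$-cube for every tiling and every set of $k$ independent flips of it, i.e. flips acting on $2\times2$ squares no two of which share a unit square; the vertices of the cube are the $2^k$ tilings obtained by performing a subset of these flips, and cubes with the same vertices are the same. A cut is a simple oriented path of edges of $R$ whose endpoints lie in different connected components of the boundary of $R$. The flow of a tiling across a cut is the number of dominoes crossing the cut, each counted with sign $+1$ or $-1$ according to whether its square to the left of the cut is black or white. A height bundle is a bundle over $R$ with fibre $\mathbb{Z}$, whose leaves over simply connected pieces are labelled by integers, labellings being glued by translations. A height section of a tiling $t$ is a section $\theta$ of such a bundle over the vertices of $R$ such that, relative to the leaves, along each oriented edge of $R$ not crossed by a domino of $t$, $\theta$ increases by $1$ if the square to the left is black and decreases by $1$ if it is white. Then: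 1. Two tilings $t_1,t_2$ of $R$ belong to the same connected component of $T$ if and only if their flows coincide across all cuts. 2. All tilings of $R$ have height sections in one common height bundle, which can be chosen so that for any two tilings in the same connected component of $T$ they coincide on the boundary of $R$. If $t_1,t_2$ lie in the same connected component of $T$ and $\theta_1,\theta_2$ are height sections of $t_1,t_2$ in the same height bundle that coincide on the boundary of $R$, then $$d(t_1,t_2)=\frac14\sum_{v}|\theta_1(v)-\theta_2(v)|,$$ where $v$ runs over the vertices of $R$. 3. Every connected component of $\mathcal{T}$ is contractible. -/

import Mathlib

namespace DominoFlip

/-- The unit square `[x, x+1] × [y, y+1]` of the plane is named by its lower left corner `(x, y)`.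
A quadriculated planar region is a finite set of unit squares, `R : Finset Cell`. -/
abbrev Cell : Type := ℤ × ℤ

/-- Vertices of the square grid. -/
abbrev Vertex : Type := ℤ × ℤ

/-- Checkerboard colouring: `1` on black squares, `-1` on white squares. -/
def colour (c : Cell) : ℤ := if Even (c.1 + c.2) then 1 else -1

/-- A domino: two unit squares with a common side (horizontal or vertical). -/
def IsDomino (d : Finset Cell) : Prop :=
  ∃ c : Cell, d = {c, c + (1, 0)} ∨ d = {c, c + (0, 1)}

/-- A domino tiling of `R`: a set of dominoes contained in `R` such that every square of `R` lies
in exactly one of them. -/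
@[ext]
structure Tiling (R : Finset Cell) where
  dominoes : Finset (Finset Cell)
  isDomino : ∀ d ∈ dominoes, IsDomino d
  subset : ∀ d ∈ dominoes, d ⊆ R
  cover : ∀ c ∈ R, ∃! d, d ∈ dominoes ∧ c ∈ d

/-- The two horizontal dominoes that form the 2 × 2 square with lower left unit square `c`. -/
def horizontalPair (c : Cell) : Finset (Finset Cell) :=
  {{c, c + (1, 0)}, {c + (0, 1), c + (1, 1)}}

/-- The two vertical dominoes that form the 2 × 2 square with lower left unit square `c`. -/
def verticalPair (c : Cell) : Finset (Finset Cell) :=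
  {{c, c + (0, 1)}, {c + (1, 0), c + (1, 1)}}

/-- The flip graph `T`: two tilings are adjacent iff they differ by lifting two dominoes that
form a 2 × 2 square and placing them back rotated by 90 degrees. -/
def flipGraph (R : Finset Cell) : SimpleGraph (Tiling R) :=
  SimpleGraph.fromRel fun t t' => ∃ c : Cell,
    horizontalPair c ⊆ t.dominoes ∧ verticalPair c ⊆ t'.dominoes ∧
      t.dominoes \ horizontalPair c = t'.dominoes \ verticalPair c

/-! ### Edges, boundary, cuts and flows -/

/-- The unit square to the left of the oriented grid edge from `v` to `w`
(the four cases are: east, north, west, south). The square to its right is `leftCell w v`. -/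
def leftCell (v w : Vertex) : Cell :=
  if w.1 = v.1 + 1 then (v.1, v.2)
  else if w.2 = v.2 + 1 then (v.1 - 1, v.2)
  else if w.1 = v.1 - 1 then (v.1 - 1, v.2 - 1)
  else (v.1, v.2 - 1)

/-- The graph of the square grid `ℤ²`. -/
def gridGraph : SimpleGraph Vertex where
  Adj v w := |w.1 - v.1| + |w.2 - v.2| = 1
  symm := ⟨fun v w h => by rwa [abs_sub_comm v.1, abs_sub_comm v.2]⟩
  loopless := ⟨fun v h => by simp at h⟩

/-- The vertices of `R`: the corners of its squares. -/
def vertices (R : Finset Cell) : Finset Vertex :=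
  R.biUnion fun c => {c, c + (1, 0), c + (0, 1), c + (1, 1)}

/-- The graph of edges of `R`: grid edges with a square of `R` on at least one side. -/
def edgeGraph (R : Finset Cell) : SimpleGraph Vertex where
  Adj v w := gridGraph.Adj v w ∧ (leftCell v w ∈ R ∨ leftCell w v ∈ R)
  symm := ⟨fun _ _ h => ⟨h.1.symm, h.2.symm⟩⟩
  loopless := ⟨fun _ h => gridGraph.irrefl h.1⟩

/-- The boundary of `R`: grid edges with a square of `R` on exactly one side. -/
def boundaryGraph (R : Finset Cell) : SimpleGraph Vertex where
  Adj v w := gridGraph.Adj v w ∧ Xor (leftCell v w ∈ R) (leftCell w v ∈ R)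
  symm := ⟨fun _ _ h => ⟨h.1.symm, (xor_comm _ _).mp h.2⟩⟩
  loopless := ⟨fun _ h => gridGraph.irrefl h.1⟩

/-- Vertices on the boundary of `R`. -/
def IsBoundaryVertex (R : Finset Cell) (v : Vertex) : Prop :=
  ∃ w, (boundaryGraph R).Adj v w

/-- A cut: a simple oriented path of edges of `R` whose endpoints lie in different connected
components of the boundary of `R`. -/
def IsCut {R : Finset Cell} {u v : Vertex} (p : (edgeGraph R).Walk u v) : Prop :=
  p.IsPath ∧ IsBoundaryVertex R u ∧ IsBoundaryVertex R v ∧ ¬ (boundaryGraph R).Reachable u v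

/-- The edge `vw` is crossed by (is the middle segment of) a domino of `t`. -/
def Tiling.Crosses {R : Finset Cell} (t : Tiling R) (v w : Vertex) : Prop :=
  ({leftCell v w, leftCell w v} : Finset Cell) ∈ t.dominoes

instance {R : Finset Cell} (t : Tiling R) (v w : Vertex) : Decidable (t.Crosses v w) :=
  inferInstanceAs (Decidable (_ ∈ t.dominoes))

/-- The flow of `t` across an oriented path: the number of dominoes crossing it, each counted
with the sign of the colour of its square to the left of the path. -/
def Tiling.flow {R : Finset Cell} (t : Tiling R) {u v : Vertex} (p : (edgeGraph R).Walk u v) : ℤ :=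
  (p.darts.map fun e => if t.Crosses e.fst e.snd then colour (leftCell e.fst e.snd) else 0).sum

/-! ### Height sections -/

/-- A bundle over `R` with fibre `ℤ` whose leaves over simply connected pieces are labelled by
the integers, in coordinates: the fibre over each vertex is identified with `ℤ`, and along the
oriented edge `vw` the leaf through `n` over `v` continues to the leaf through `n + shift v w`
over `w`. Leaves close up around every square of `R`. -/
structure HeightBundle (R : Finset Cell) where
  shift : Vertex → Vertex → ℤ
  shift_symm : ∀ v w, (edgeGraph R).Adj v w → shift w v = -shift v w
  flat : ∀ c ∈ R, shift c (c + (1, 0)) + shift (c + (1, 0)) (c + (1, 1)) +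
    shift (c + (1, 1)) (c + (0, 1)) + shift (c + (0, 1)) c = 0

/-- `θ` is a height section of `t` in the bundle `L`: in terms of the leaves of `L`, along every
oriented edge of `R` not crossed by a domino of `t` the height increases by `1` if the square to
the left is black and decreases by `1` if it is white. (For the one crossed edge of a square the
change, `∓3`, follows by going around that square.) -/
def IsHeightSection {R : Finset Cell} (L : HeightBundle R) (t : Tiling R) (θ : Vertex → ℤ) : Prop :=
  ∀ v w, (edgeGraph R).Adj v w → ¬ t.Crosses v w →
    θ w = θ v + L.shift v w + colour (leftCell v w)

/-! ### The complex of flips -/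

/-- The unit squares covered by the dominoes lifted when passing from `t` to `t'`; if `t`, `t'`
differ by a flip, this is the 2 × 2 square on which the flip acts. -/
def flipSquare {R : Finset Cell} (t t' : Tiling R) : Finset Cell :=
  (t.dominoes \ t'.dominoes).biUnion id

/-- `S` is a set of independent flips of `t`, a flip being named by the tiling it leads to: the
flips in `S` act on pairwise disjoint 2 × 2 squares. -/
def IndependentFlips {R : Finset Cell} (t : Tiling R) (S : Finset (Tiling R)) : Prop :=
  (∀ t' ∈ S, (flipGraph R).Adj t t') ∧
    (S : Set (Tiling R)).Pairwise fun t' t'' => Disjoint (flipSquare t t') (flipSquare t t'')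

/-- The 0-cell of the tiling `t`: the indicator function of its set of dominoes. -/
def Tiling.point {R : Finset Cell} (t : Tiling R) : Finset Cell → ℝ :=
  fun d => if d ∈ t.dominoes then 1 else 0

/-- The characteristic map of the `k`-cell of `k` independent flips `S` of `t`, on the cube
`[0,1]^S`: the coordinate `a t'` tells how far the flip from `t` to `t'` has been carried out.
Its values at the `2^k` vertices of the cube are the 0-cells of the tilings obtained from `t` by
performing a subset of the flips. -/
noncomputable def cellMap {R : Finset Cell} (t : Tiling R) (S : Finset (Tiling R))
    (a : Tiling R → ℝ) : Finset Cell → ℝ :=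
  t.point + ∑ t' ∈ S, a t' • (t'.point - t.point)

/-- The complex `𝒯`: the union of all the cubes of independent flips, realized in the space of
real functions on dominoes. These finitely many cubes are embedded by their characteristic maps and
meet exactly in common faces, so that this is the cube complex obtained from the
flip graph by gluing one `k`-cube for each set of `k` independent flips. -/
def flipComplex (R : Finset Cell) : Set (Finset Cell → ℝ) :=
  {x | ∃ (t : Tiling R) (S : Finset (Tiling R)), IndependentFlips t S ∧
    ∃ a : Tiling R → ℝ, (∀ t', a t' ∈ Set.Icc (0 : ℝ) 1) ∧ cellMap t S a = x}

end DominoFlip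

open DominoFlip

/-!
The difference of two tilings, as a signed weight on dominoes, has total weight zero around every
unit square, so it is the coboundary of a potential on the vertices: the height difference of the
tilings, an integer function in units of four heights. It vanishes off the interior of `R` exactly
when the flows agree, and a flip changes it by `±1` at one interior vertex. Suppose that the
difference of `t` and `t'` vanishes off the interior and has a positive maximum. Some flip of `t`
decreases the height at one of the vertices where the maximum is attained. Otherwise these vertices
would carry closed staircases, alternating between horizontal and vertical edges not crossed by
dominoes of `t`; an extreme corner of such staircases always abuts a domino of `t`, and they could
be pushed across it, without leaving the set of maxima, forever. Hence the distance of `t` and `t'`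
is the sum of the absolute height differences.

The points of a component of the complex correspond to real height functions: between integers
heights move linearly, and no two adjacent heights move at the same time. The meet of two such
functions is again one. Following a path of flips from the greatest to the least height function
and taking the meet with each function contracts the component.
-/

namespace DominoFlip

variable {R : Finset Cell}

/-! ### Dominoes and edges -/

/-- The horizontal domino whose left square is `(x, y)`. -/
def hDomino (x y : ℤ) : Finset Cell := {(x, y), (x + 1, y)}

/-- The vertical domino whose lower square is `(x, y)`. -/
def vDomino (x y : ℤ) : Finset Cell := {(x, y), (x, y + 1)}

lemma mem_hDomino {x y : ℤ} {c : Cell} : c ∈ hDomino x y ↔ c = (x, y) ∨ c = (x + 1, y) := by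
  simp [hDomino]

lemma mem_vDomino {x y : ℤ} {c : Cell} : c ∈ vDomino x y ↔ c = (x, y) ∨ c = (x, y + 1) := by
  simp [vDomino]

lemma isDomino_iff {d : Finset Cell} : IsDomino d ↔ ∃ x y, d = hDomino x y ∨ d = vDomino x y := by
  simp [IsDomino, hDomino, vDomino, Prod.exists]

lemma isDomino_hDomino (x y : ℤ) : IsDomino (hDomino x y) := isDomino_iff.2 ⟨x, y, Or.inl rfl⟩

lemma isDomino_vDomino (x y : ℤ) : IsDomino (vDomino x y) := isDomino_iff.2 ⟨x, y, Or.inr rfl⟩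

lemma hDomino_inj {x y x' y' : ℤ} : hDomino x y = hDomino x' y' ↔ x = x' ∧ y = y' := by
  refine ⟨fun h => ?_, fun h => by rw [h.1, h.2]⟩
  have left : ((x, y) : Cell) ∈ hDomino x' y' := h ▸ mem_hDomino.2 (Or.inl rfl)
  have right : ((x + 1, y) : Cell) ∈ hDomino x' y' := h ▸ mem_hDomino.2 (Or.inr rfl)
  simp only [mem_hDomino, Prod.mk.injEq] at left right
  omega

lemma vDomino_inj {x y x' y' : ℤ} : vDomino x y = vDomino x' y' ↔ x = x' ∧ y = y' := by
  refine ⟨fun h => ?_, fun h => by rw [h.1, h.2]⟩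
  have lower : ((x, y) : Cell) ∈ vDomino x' y' := h ▸ mem_vDomino.2 (Or.inl rfl)
  have upper : ((x, y + 1) : Cell) ∈ vDomino x' y' := h ▸ mem_vDomino.2 (Or.inr rfl)
  simp only [mem_vDomino, Prod.mk.injEq] at lower upper
  omega

lemma hDomino_ne_vDomino {x y x' y' : ℤ} : hDomino x y ≠ vDomino x' y' := by
  intro h
  have left : ((x, y) : Cell) ∈ vDomino x' y' := h ▸ mem_hDomino.2 (Or.inl rfl)
  have right : ((x + 1, y) : Cell) ∈ vDomino x' y' := h ▸ mem_hDomino.2 (Or.inr rfl)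
  simp only [mem_vDomino, Prod.mk.injEq] at left right
  omega

lemma vDomino_ne_hDomino {x y x' y' : ℤ} : vDomino x y ≠ hDomino x' y' := hDomino_ne_vDomino.symm

lemma hDomino_subset {x y : ℤ} : hDomino x y ⊆ R ↔ (x, y) ∈ R ∧ (x + 1, y) ∈ R := by
  simp [hDomino, Finset.insert_subset_iff]

lemma vDomino_subset {x y : ℤ} : vDomino x y ⊆ R ↔ (x, y) ∈ R ∧ (x, y + 1) ∈ R := by
  simp [vDomino, Finset.insert_subset_iff]

/-- The four dominoes that contain the unit square `(x, y)`. -/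
def dominoesAt (x y : ℤ) : Finset (Finset Cell) :=
  {hDomino x y, hDomino (x - 1) y, vDomino x y, vDomino x (y - 1)}

lemma mem_dominoesAt {x y : ℤ} {d : Finset Cell} :
    d ∈ dominoesAt x y ↔ IsDomino d ∧ (x, y) ∈ d := by
  simp only [dominoesAt, Finset.mem_insert, Finset.mem_singleton]
  constructor
  · rintro (rfl | rfl | rfl | rfl) <;>
      simp [isDomino_hDomino, isDomino_vDomino, mem_hDomino, mem_vDomino]
  · rintro ⟨hd, h⟩
    obtain ⟨a, b, rfl | rfl⟩ := isDomino_iff.1 hd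
    · rcases mem_hDomino.1 h with h | h <;> obtain ⟨rfl, rfl⟩ := Prod.mk.inj h <;> simp
    · rcases mem_vDomino.1 h with h | h <;> obtain ⟨rfl, rfl⟩ := Prod.mk.inj h <;> simp

lemma colour_east (x y : ℤ) : colour (x + 1, y) = -colour (x, y) := by
  have : Even (x + 1 + y) ↔ ¬ Even (x + y) := by rw [add_right_comm, Int.even_add_one]
  by_cases h : Even (x + y) <;> simp [colour, this, h]

lemma colour_north (x y : ℤ) : colour (x, y + 1) = -colour (x, y) := by
  have : Even (x + (y + 1)) ↔ ¬ Even (x + y) := by rw [← add_assoc, Int.even_add_one]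
  by_cases h : Even (x + y) <;> simp [colour, this, h]

lemma colour_west (x y : ℤ) : colour (x - 1, y) = -colour (x, y) := by
  rw [eq_neg_iff_add_eq_zero, ← neg_eq_iff_add_eq_zero, ← colour_east, sub_add_cancel]

lemma colour_south (x y : ℤ) : colour (x, y - 1) = -colour (x, y) := by
  rw [eq_neg_iff_add_eq_zero, ← neg_eq_iff_add_eq_zero, ← colour_north, sub_add_cancel]

lemma colour_eq_or (c : Cell) : colour c = 1 ∨ colour c = -1 := by
  unfold colour
  split_ifs <;> simp

lemma colour_mul_self (c : Cell) : colour c * colour c = 1 := by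
  rcases colour_eq_or c with h | h <;> simp [h]

lemma leftCell_east (x y : ℤ) : leftCell (x, y) (x + 1, y) = (x, y) := by simp [leftCell]

lemma leftCell_west (x y : ℤ) : leftCell (x + 1, y) (x, y) = (x, y - 1) := by
  simp [leftCell, show x ≠ x + 1 + 1 by lia]

lemma leftCell_north (x y : ℤ) : leftCell (x, y) (x, y + 1) = (x - 1, y) := by simp [leftCell]

lemma leftCell_south (x y : ℤ) : leftCell (x, y + 1) (x, y) = (x, y) := by
  simp [leftCell, show y ≠ y + 1 + 1 by lia, show x ≠ x - 1 by lia]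

lemma gridGraph_adj_east (x y : ℤ) : gridGraph.Adj (x, y) (x + 1, y) := by simp [gridGraph]

lemma gridGraph_adj_north (x y : ℤ) : gridGraph.Adj (x, y) (x, y + 1) := by simp [gridGraph]

@[elab_as_elim]
lemma gridGraph_adj_cases {P : ∀ v w, gridGraph.Adj v w → Prop}
    (east : ∀ x y, P (x, y) (x + 1, y) (gridGraph_adj_east x y))
    (west : ∀ x y, P (x + 1, y) (x, y) (gridGraph_adj_east x y).symm)
    (north : ∀ x y, P (x, y) (x, y + 1) (gridGraph_adj_north x y))
    (south : ∀ x y, P (x, y + 1) (x, y) (gridGraph_adj_north x y).symm)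
    {v w : Vertex} (h : gridGraph.Adj v w) : P v w h := by
  obtain ⟨a, b⟩ := v
  obtain ⟨x, y⟩ := w
  have habs : |x - a| + |y - b| = 1 := h
  have : (x = a + 1 ∧ y = b) ∨ (a = x + 1 ∧ y = b) ∨ (x = a ∧ y = b + 1) ∨ (x = a ∧ b = y + 1) := by
    rcases abs_cases (x - a) with h1 | h1 <;> rcases abs_cases (y - b) with h2 | h2 <;> omega
  rcases this with ⟨rfl, rfl⟩ | ⟨rfl, rfl⟩ | ⟨rfl, rfl⟩ | ⟨rfl, rfl⟩
  · exact east _ _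
  · exact west _ _
  · exact north _ _
  · exact south _ _

/-- The domino that crosses the edge `vw`. -/
def edgeDomino (v w : Vertex) : Finset Cell := {leftCell v w, leftCell w v}

lemma edgeDomino_comm (v w : Vertex) : edgeDomino w v = edgeDomino v w := Finset.pair_comm _ _

lemma edgeDomino_east (x y : ℤ) : edgeDomino (x, y) (x + 1, y) = vDomino x (y - 1) := by
  rw [edgeDomino, leftCell_east, leftCell_west, vDomino, sub_add_cancel, Finset.pair_comm]

lemma edgeDomino_north (x y : ℤ) : edgeDomino (x, y) (x, y + 1) = hDomino (x - 1) y := by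
  rw [edgeDomino, leftCell_north, leftCell_south, hDomino, sub_add_cancel]

lemma edgeDomino_subset {v w : Vertex} :
    edgeDomino v w ⊆ R ↔ leftCell v w ∈ R ∧ leftCell w v ∈ R := by
  simp [edgeDomino, Finset.insert_subset_iff]

lemma colour_leftCell_swap {v w : Vertex} (h : gridGraph.Adj v w) :
    colour (leftCell w v) = -colour (leftCell v w) := by
  induction h using gridGraph_adj_cases <;>
    simp only [leftCell_east, leftCell_west, leftCell_north, leftCell_south, colour_south,
      colour_west, neg_neg]

/-! ### Tilings as weights -/

/-- The indicator function of the set of dominoes of a tiling. -/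
def Tiling.ind (t : Tiling R) (d : Finset Cell) : ℤ := if d ∈ t.dominoes then 1 else 0

lemma Tiling.ind_eq_or (t : Tiling R) (d : Finset Cell) : t.ind d = 0 ∨ t.ind d = 1 := by
  unfold Tiling.ind
  split_ifs <;> simp

lemma Tiling.ind_eq_one {t : Tiling R} {d : Finset Cell} : t.ind d = 1 ↔ d ∈ t.dominoes := by
  simp [Tiling.ind]

lemma Tiling.ind_eq_zero {t : Tiling R} {d : Finset Cell} : t.ind d = 0 ↔ d ∉ t.dominoes := by
  simp [Tiling.ind]

lemma Tiling.ind_injective : Function.Injective (Tiling.ind : Tiling R → Finset Cell → ℤ) := by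
  intro t t' h
  ext d
  rw [← Tiling.ind_eq_one, ← Tiling.ind_eq_one, h]

lemma Tiling.crosses_iff {t : Tiling R} {v w : Vertex} :
    t.Crosses v w ↔ t.ind (edgeDomino v w) = 1 := Tiling.ind_eq_one.symm

lemma Tiling.point_apply (t : Tiling R) (d : Finset Cell) : t.point d = (t.ind d : ℝ) := by
  unfold Tiling.point Tiling.ind
  split_ifs <;> simp

lemma Tiling.eq_of_mem (t : Tiling R) {c : Cell} {d d' : Finset Cell} (hd : d ∈ t.dominoes)
    (hd' : d' ∈ t.dominoes) (hc : c ∈ d) (hc' : c ∈ d') : d = d' :=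
  (t.cover c (t.subset d hd hc)).unique ⟨hd, hc⟩ ⟨hd', hc'⟩

/-- The weight `z` is supported on the dominoes contained in `R`. -/
def IsSupported (R : Finset Cell) {A : Type*} [Zero A] (z : Finset Cell → A) : Prop :=
  ∀ d, z d ≠ 0 → IsDomino d ∧ d ⊆ R

/-- The total weight of the dominoes that contain the unit square `(x, y)`. -/
def cellSum {A : Type*} [AddCommMonoid A] (z : Finset Cell → A) (x y : ℤ) : A :=
  ∑ d ∈ dominoesAt x y, z d

lemma cellSum_eq {A : Type*} [AddCommMonoid A] (z : Finset Cell → A) (x y : ℤ) :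
    cellSum z x y =
      z (hDomino x y) + z (hDomino (x - 1) y) + z (vDomino x y) + z (vDomino x (y - 1)) := by
  have hx : x ≠ x - 1 := by omega
  have hy : y ≠ y - 1 := by omega
  rw [cellSum, dominoesAt, Finset.sum_insert, Finset.sum_insert, Finset.sum_insert,
    Finset.sum_singleton, add_assoc, add_assoc] <;>
  simp [hDomino_inj, vDomino_inj, hDomino_ne_vDomino, hx, hy]

lemma Tiling.isSupported_ind (t : Tiling R) : IsSupported R t.ind := by
  intro d hd
  have hdt : d ∈ t.dominoes := by simpa using mt Tiling.ind_eq_zero.2 hd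
  exact ⟨t.isDomino d hdt, t.subset d hdt⟩

lemma Tiling.ind_edgeDomino_eq_zero (t : Tiling R) {v w : Vertex}
    (h : ¬ (leftCell v w ∈ R ∧ leftCell w v ∈ R)) : t.ind (edgeDomino v w) = 0 :=
  Tiling.ind_eq_zero.2 fun hmem => h (edgeDomino_subset.1 (t.subset _ hmem))

lemma existsUnique_of_cellSum_eq_one {z : Finset Cell → ℤ} (h01 : ∀ d, z d = 0 ∨ z d = 1)
    {x y : ℤ} : cellSum z x y = 1 ↔ ∃! d, z d = 1 ∧ IsDomino d ∧ (x, y) ∈ d := by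
  have hz : ∀ d, z d = if z d = 1 then 1 else 0 := fun d => by rcases h01 d with h | h <;> simp [h]
  rw [cellSum, Finset.sum_congr rfl fun d _ => hz d, Finset.sum_boole, Nat.cast_eq_one,
    Finset.card_eq_one_iff_existsUnique]
  simp only [Finset.mem_filter, mem_dominoesAt, and_comm]

lemma Tiling.cellSum_ind (t : Tiling R) {x y : ℤ} (h : (x, y) ∈ R) : cellSum t.ind x y = 1 := by
  rw [existsUnique_of_cellSum_eq_one t.ind_eq_or]
  simp only [Tiling.ind_eq_one]
  obtain ⟨d, ⟨hd, hmem⟩, huniq⟩ := t.cover _ h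
  exact ⟨d, ⟨hd, t.isDomino d hd, hmem⟩, fun d' h' => huniq d' ⟨h'.1, h'.2.2⟩⟩

lemma exists_tiling_of_weight {z : Finset Cell → ℤ} (h01 : ∀ d, z d = 0 ∨ z d = 1)
    (hs : IsSupported R z) (hsum : ∀ x y, (x, y) ∈ R → cellSum z x y = 1) :
    ∃ t : Tiling R, t.ind = z := by
  have hdom : ∀ d, z d = 1 → IsDomino d ∧ d ⊆ R := fun d hd => hs d (by simp [hd])
  have mem : ∀ d, d ∈ R.powerset.filter (fun d => z d = 1) ↔ z d = 1 := fun d => by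
    simpa using fun hd => (hdom d hd).2
  refine ⟨⟨R.powerset.filter (fun d => z d = 1), fun d hd => (hdom d ((mem d).1 hd)).1,
    fun d hd => (hdom d ((mem d).1 hd)).2, fun ⟨x, y⟩ hc => ?_⟩, funext fun d => ?_⟩
  · obtain ⟨d, ⟨hd, -, hmem⟩, huniq⟩ := (existsUnique_of_cellSum_eq_one h01).1 (hsum x y hc)
    refine ⟨d, ⟨(mem d).2 hd, hmem⟩, fun d' ⟨hd', hmem'⟩ => ?_⟩
    exact huniq d' ⟨(mem d').1 hd', (hdom d' ((mem d').1 hd')).1, hmem'⟩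
  · simp only [Tiling.ind, mem]
    rcases h01 d with h | h <;> simp [h]

/-! ### Circulations and potentials -/

section Circulation

variable {A : Type*} [CommRing A]

lemma IsSupported.hDomino_eq_zero {z : Finset Cell → A} (hz : IsSupported R z) {x y : ℤ}
    (h : (x, y) ∉ R) : z (hDomino x y) = 0 := by
  by_contra hne
  exact h (hDomino_subset.1 (hz _ hne).2).1

lemma IsSupported.vDomino_eq_zero {z : Finset Cell → A} (hz : IsSupported R z) {x y : ℤ}
    (h : (x, y + 1) ∉ R) : z (vDomino x y) = 0 := by
  by_contra hne
  exact h (vDomino_subset.1 (hz _ hne).2).2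

lemma IsSupported.add {z w : Finset Cell → A} (hz : IsSupported R z) (hw : IsSupported R w) :
    IsSupported R (z + w) := by
  intro d h
  by_cases hzd : z d = 0
  · exact hw d fun hwd => h (by simp [hzd, hwd])
  · exact hz d hzd

lemma IsSupported.neg {z : Finset Cell → A} (hz : IsSupported R z) : IsSupported R (-z) :=
  fun d h => hz d (neg_ne_zero.1 h)

lemma IsSupported.cellSum_eq_zero {z : Finset Cell → A} (hz : IsSupported R z) {x y : ℤ}
    (h : (x, y) ∉ R) : cellSum z x y = 0 := by
  refine Finset.sum_eq_zero fun d hd => ?_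
  by_contra hne
  exact h ((hz d hne).2 (mem_dominoesAt.1 hd).2)

lemma cellSum_add (z w : Finset Cell → A) (x y : ℤ) :
    cellSum (z + w) x y = cellSum z x y + cellSum w x y := Finset.sum_add_distrib

lemma cellSum_smul (a : A) (z : Finset Cell → A) (x y : ℤ) :
    cellSum (a • z) x y = a * cellSum z x y := (Finset.mul_sum ..).symm

variable (R) (A) in
/-- The weights on the dominoes of `R` with total weight zero around each unit square, such as
differences of tilings. Weighting each edge by the domino that crosses it, with sign, they become
the closed `1`-forms on the grid that vanish off the edges inside `R`. -/
def circulations : Submodule A (Finset Cell → A) where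
  carrier := {z | IsSupported R z ∧ ∀ x y, cellSum z x y = 0}
  zero_mem' := ⟨fun d h => absurd rfl h, fun x y => Finset.sum_const_zero⟩
  add_mem' := fun ⟨hz, hz0⟩ ⟨hw, hw0⟩ =>
    ⟨hz.add hw, fun x y => by rw [cellSum_add, hz0, hw0, add_zero]⟩
  smul_mem' := fun a _ ⟨hz, hz0⟩ =>
    ⟨fun d h => hz d (right_ne_zero_of_mul h), fun x y => by rw [cellSum_smul, hz0, mul_zero]⟩

lemma ind_sub_ind_mem_circulations (t t' : Tiling R) : t.ind - t'.ind ∈ circulations R ℤ := by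
  have hs : IsSupported R (t.ind - t'.ind) :=
    sub_eq_add_neg t.ind t'.ind ▸ t.isSupported_ind.add t'.isSupported_ind.neg
  refine ⟨hs, fun x y => ?_⟩
  by_cases h : (x, y) ∈ R
  · have hsub : cellSum (t.ind - t'.ind) x y = cellSum t.ind x y - cellSum t'.ind x y :=
      Finset.sum_sub_distrib ..
    rw [hsub, t.cellSum_ind h, t'.cellSum_ind h, sub_self]
  · exact hs.cellSum_eq_zero h

lemma intCast_mem_circulations {z : Finset Cell → ℤ} (hz : z ∈ circulations R ℤ) :
    (fun d => (z d : A)) ∈ circulations R A := by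
  refine ⟨fun d h => hz.1 d fun h0 => h (by simp [h0]), fun x y => ?_⟩
  have := congrArg (Int.cast : ℤ → A) (hz.2 x y)
  simpa [cellSum] using this

variable (R) in
/-- The function on the vertices whose increments along the edges are prescribed by a circulation,
normalized to vanish far to the west. -/
def potential : (Finset Cell → A) →ₗ[A] (Vertex → A) :=
  LinearMap.pi fun v =>
    ∑ c ∈ R with c.2 = v.2 ∧ c.1 < v.1, (colour c : A) • LinearMap.proj (vDomino c.1 (c.2 - 1))

lemma potential_apply (z : Finset Cell → A) (v : Vertex) : potential R z v =
    ∑ c ∈ R with c.2 = v.2 ∧ c.1 < v.1, (colour c : A) * z (vDomino c.1 (c.2 - 1)) := by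
  simp [potential]

lemma potential_intCast (z : Finset Cell → ℤ) (v : Vertex) :
    potential R (fun d => (z d : A)) v = (potential R z v : ℤ) := by
  simp [potential_apply]

variable (R) in
lemma west_induction {P : ℤ → Prop} (base : ∀ x, (∀ c ∈ R, x ≤ c.1) → P x)
    (step : ∀ x, P x → P (x + 1)) (x : ℤ) : P x := by
  obtain ⟨b, hb⟩ := (R.image Prod.fst).bddBelow
  have hR : ∀ c ∈ R, b ≤ c.1 := fun c hc => hb (Finset.mem_image_of_mem _ hc)
  obtain h | h := le_total x b
  · exact base x fun c hc => h.trans (hR c hc)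
  · induction x, h using Int.leInduction with
    | base => exact base b hR
    | succ x _ ih => exact step x ih

lemma potential_eq_zero_of_west (z : Finset Cell → A) {x y : ℤ} (h : ∀ c ∈ R, x ≤ c.1) :
    potential R z (x, y) = 0 := by
  rw [potential_apply, Finset.filter_false_of_mem, Finset.sum_empty]
  exact fun c hc hlt => (h c hc).not_gt hlt.2

lemma IsSupported.potential_east {z : Finset Cell → A} (hz : IsSupported R z) (x y : ℤ) :
    potential R z (x + 1, y) =
      potential R z (x, y) + (colour (x, y) : A) * z (vDomino x (y - 1)) := by
  rw [potential_apply, potential_apply]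
  by_cases h : (x, y) ∈ R
  · have hinsert : {c ∈ R | c.2 = y ∧ c.1 < x + 1} = insert (x, y) {c ∈ R | c.2 = y ∧ c.1 < x} := by
      ext ⟨a, b⟩
      simp only [Finset.mem_filter, Finset.mem_insert, Prod.mk.injEq]
      grind
    rw [hinsert, Finset.sum_insert (by simp), add_comm]
  · have hsame : {c ∈ R | c.2 = y ∧ c.1 < x + 1} = {c ∈ R | c.2 = y ∧ c.1 < x} := by
      refine Finset.filter_congr fun c hc => and_congr_right fun hy => ?_
      have : c.1 ≠ x := fun hx => h (by rwa [← hx, ← hy])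
      omega
    rw [hsame, hz.vDomino_eq_zero (by simpa using h), mul_zero, add_zero]

lemma potential_north {z : Finset Cell → A} (hz : z ∈ circulations R A) (x y : ℤ) :
    potential R z (x, y + 1) =
      potential R z (x, y) - (colour (x, y) : A) * z (hDomino (x - 1) y) := by
  induction x using west_induction R with
  | base x h =>
    have hmem : (x - 1, y) ∉ R := fun hmem => by have := h _ hmem; omega
    rw [potential_eq_zero_of_west z h, potential_eq_zero_of_west z h, hz.1.hDomino_eq_zero hmem,
      mul_zero, sub_zero]
  | step x ih =>
    have := hz.2 x y
    rw [cellSum_eq] at this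
    rw [hz.1.potential_east, hz.1.potential_east, ih, colour_north, colour_east]
    simp only [add_sub_cancel_right, Int.cast_neg]
    linear_combination (-(colour (x, y) : A)) * this

lemma potential_step {z : Finset Cell → A} (hz : z ∈ circulations R A) {v w : Vertex}
    (h : gridGraph.Adj v w) :
    potential R z w = potential R z v + (colour (leftCell v w) : A) * z (edgeDomino v w) := by
  induction h using gridGraph_adj_cases with
  | east x y => rw [leftCell_east, edgeDomino_east, hz.1.potential_east]
  | west x y =>
    rw [leftCell_west, edgeDomino_comm, edgeDomino_east, hz.1.potential_east, colour_south]
    push_cast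
    ring
  | north x y =>
    rw [leftCell_north, edgeDomino_north, potential_north hz, colour_west]
    push_cast
    ring
  | south x y =>
    rw [leftCell_south, edgeDomino_comm, edgeDomino_north, potential_north hz]
    ring

/-- All four unit squares around `v` lie in `R`. -/
def IsInterior (R : Finset Cell) (v : Vertex) : Prop :=
  (v.1, v.2) ∈ R ∧ (v.1 - 1, v.2) ∈ R ∧ (v.1, v.2 - 1) ∈ R ∧ (v.1 - 1, v.2 - 1) ∈ R

/-- The function `h` vanishes off the interior vertices of `R`. -/
def VanishesOutside (R : Finset Cell) (h : Vertex → A) : Prop :=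
  ∀ v, ¬ IsInterior R v → h v = 0

/-- The weight of each domino is the signed increment of `h` along the edge that the domino
crosses; see `coboundary_edgeDomino`. Only the left or lower unit square of a domino contributes to
the sum. -/
def coboundary (h : Vertex → A) (d : Finset Cell) : A :=
  ∑ c ∈ d, (colour c : A) *
    if d = hDomino c.1 c.2 then h (c.1 + 1, c.2 + 1) - h (c.1 + 1, c.2)
    else if d = vDomino c.1 c.2 then h (c.1, c.2 + 1) - h (c.1 + 1, c.2 + 1) else 0

lemma coboundary_hDomino (h : Vertex → A) (x y : ℤ) :
    coboundary h (hDomino x y) = (colour (x, y) : A) * (h (x + 1, y + 1) - h (x + 1, y)) := by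
  simp only [coboundary, hDomino_inj, hDomino_ne_vDomino, if_false]
  rw [hDomino, Finset.sum_pair (by simp)]
  simp

lemma coboundary_vDomino (h : Vertex → A) (x y : ℤ) :
    coboundary h (vDomino x y) = (colour (x, y) : A) * (h (x, y + 1) - h (x + 1, y + 1)) := by
  simp only [coboundary, vDomino_inj, vDomino_ne_hDomino, if_false]
  rw [vDomino, Finset.sum_pair (by simp)]
  simp

lemma coboundary_edgeDomino (h : Vertex → A) {v w : Vertex} (hvw : gridGraph.Adj v w) :
    coboundary h (edgeDomino v w) = (colour (leftCell v w) : A) * (h w - h v) := by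
  induction hvw using gridGraph_adj_cases with
  | east x y =>
    rw [leftCell_east, edgeDomino_east, coboundary_vDomino, colour_south, sub_add_cancel]
    push_cast
    ring
  | west x y =>
    rw [leftCell_west, edgeDomino_comm, edgeDomino_east, coboundary_vDomino, sub_add_cancel]
  | north x y => rw [leftCell_north, edgeDomino_north, coboundary_hDomino, sub_add_cancel]
  | south x y =>
    rw [leftCell_south, edgeDomino_comm, edgeDomino_north, coboundary_hDomino, colour_west,
      sub_add_cancel]
    push_cast
    ring

lemma coboundary_eq_zero_of_not_isDomino (h : Vertex → A) {d : Finset Cell}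
    (hd : ¬ IsDomino d) : coboundary h d = 0 := by
  refine Finset.sum_eq_zero fun c _ => ?_
  have hh : d ≠ hDomino c.1 c.2 := fun e => hd (e ▸ isDomino_hDomino _ _)
  have hv : d ≠ vDomino c.1 c.2 := fun e => hd (e ▸ isDomino_vDomino _ _)
  rw [if_neg hh, if_neg hv, mul_zero]

lemma coboundary_zero : coboundary (0 : Vertex → A) = 0 := by
  funext d
  simp [coboundary]

lemma VanishesOutside.isSupported_coboundary {h : Vertex → A} (hh : VanishesOutside R h) :
    IsSupported R (coboundary h) := by
  intro d hne
  have hd : IsDomino d := by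
    by_contra hd
    exact hne (coboundary_eq_zero_of_not_isDomino h hd)
  refine ⟨hd, ?_⟩
  by_contra hR
  apply hne
  obtain ⟨x, y, rfl | rfl⟩ := isDomino_iff.1 hd
  · rw [hDomino_subset] at hR
    rw [coboundary_hDomino, hh, hh, sub_zero, mul_zero] <;>
    · simp only [IsInterior, add_sub_cancel_right]
      tauto
  · rw [vDomino_subset] at hR
    rw [coboundary_vDomino, hh, hh, sub_zero, mul_zero] <;>
    · simp only [IsInterior, add_sub_cancel_right]
      tauto

lemma VanishesOutside.coboundary_mem_circulations {h : Vertex → A} (hh : VanishesOutside R h) :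
    coboundary h ∈ circulations R A := by
  refine ⟨hh.isSupported_coboundary, fun x y => ?_⟩
  rw [cellSum_eq, coboundary_hDomino, coboundary_hDomino, coboundary_vDomino, coboundary_vDomino,
    colour_west, colour_south]
  simp only [sub_add_cancel, Int.cast_neg]
  ring

lemma IsDomino.exists_edge {d : Finset Cell} (hd : IsDomino d) :
    ∃ v w, gridGraph.Adj v w ∧ edgeDomino v w = d := by
  obtain ⟨x, y, rfl | rfl⟩ := isDomino_iff.1 hd
  · exact ⟨(x + 1, y), (x + 1, y + 1), gridGraph_adj_north .., by
      rw [edgeDomino_north, add_sub_cancel_right]⟩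
  · exact ⟨(x, y + 1), (x + 1, y + 1), gridGraph_adj_east .., by
      rw [edgeDomino_east, add_sub_cancel_right]⟩

lemma colour_mul_colour_mul (c : Cell) (a : A) : (colour c : A) * ((colour c : A) * a) = a := by
  rw [← mul_assoc, ← Int.cast_mul, colour_mul_self, Int.cast_one, one_mul]

lemma coboundary_potential {z : Finset Cell → A} (hz : z ∈ circulations R A) :
    coboundary (potential R z) = z := by
  funext d
  by_cases hd : IsDomino d
  · obtain ⟨v, w, hvw, rfl⟩ := hd.exists_edge
    rw [coboundary_edgeDomino _ hvw, potential_step hz hvw, add_sub_cancel_left,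
      colour_mul_colour_mul]
  · rw [coboundary_eq_zero_of_not_isDomino _ hd]
    by_contra h
    exact hd (hz.1 d (Ne.symm h)).1

lemma VanishesOutside.potential_coboundary {h : Vertex → A} (hh : VanishesOutside R h) :
    potential R (coboundary h) = h := by
  funext ⟨x, y⟩
  induction x using west_induction R with
  | base x hx =>
    rw [potential_eq_zero_of_west _ hx, hh]
    rintro ⟨-, hmem, -⟩
    have := hx _ hmem
    dsimp only at this
    omega
  | step x ih =>
    rw [potential_step hh.coboundary_mem_circulations (gridGraph_adj_east x y),
      coboundary_edgeDomino h (gridGraph_adj_east x y), colour_mul_colour_mul, ih,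
      add_sub_cancel]

end Circulation

/-! ### Height differences of tilings -/

/-- The difference of the height functions of two tilings, in units of `-4`, normalized to vanish
far to the west. -/
def heightDiff (t t' : Tiling R) : Vertex → ℤ := potential R (t.ind - t'.ind)

lemma heightDiff_self (t : Tiling R) : heightDiff t t = 0 := by
  rw [heightDiff, sub_self, map_zero]

lemma heightDiff_add (t t' t'' : Tiling R) :
    heightDiff t t' + heightDiff t' t'' = heightDiff t t'' := by
  rw [heightDiff, heightDiff, heightDiff, ← map_add, sub_add_sub_cancel]

lemma heightDiff_add_apply (t t' t'' : Tiling R) (v : Vertex) :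
    heightDiff t t' v + heightDiff t' t'' v = heightDiff t t'' v :=
  congrFun (heightDiff_add t t' t'') v

lemma heightDiff_swap (t t' : Tiling R) : heightDiff t' t = -heightDiff t t' := by
  rw [eq_neg_iff_add_eq_zero, heightDiff_add, heightDiff_self]

lemma heightDiff_step (t t' : Tiling R) {v w : Vertex} (h : gridGraph.Adj v w) :
    heightDiff t t' w = heightDiff t t' v +
      colour (leftCell v w) * (t.ind (edgeDomino v w) - t'.ind (edgeDomino v w)) := by
  simpa [heightDiff] using potential_step (ind_sub_ind_mem_circulations t t') h

lemma coboundary_heightDiff (t t' : Tiling R) : coboundary (heightDiff t t') = t.ind - t'.ind :=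
  coboundary_potential (ind_sub_ind_mem_circulations t t')

lemma eq_of_heightDiff_eq_zero {t t' : Tiling R} (h : heightDiff t t' = 0) : t = t' := by
  apply Tiling.ind_injective
  rw [← sub_eq_zero, ← coboundary_heightDiff, h, coboundary_zero]

/-- The heights of the two tilings agree off the interior of `R`. -/
def SameBoundary (t t' : Tiling R) : Prop := VanishesOutside R (heightDiff t t')

lemma SameBoundary.refl (t : Tiling R) : SameBoundary t t :=
  fun v _ => by rw [heightDiff_self, Pi.zero_apply]

lemma SameBoundary.symm {t t' : Tiling R} (h : SameBoundary t t') : SameBoundary t' t :=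
  fun v hv => by rw [heightDiff_swap, Pi.neg_apply, h v hv, neg_zero]

lemma SameBoundary.trans {t t' t'' : Tiling R} (h : SameBoundary t t')
    (h' : SameBoundary t' t'') : SameBoundary t t'' :=
  fun v hv => by rw [← heightDiff_add_apply t t' t'', h v hv, h' v hv, add_zero]

lemma exists_tiling_of_height (t₀ : Tiling R) {h : Vertex → ℤ} (hh : VanishesOutside R h)
    (h01 : ∀ d, t₀.ind d + coboundary h d = 0 ∨ t₀.ind d + coboundary h d = 1) :
    ∃ t : Tiling R, heightDiff t t₀ = h := by
  have hc := hh.coboundary_mem_circulations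
  obtain ⟨t, ht⟩ := exists_tiling_of_weight (z := t₀.ind + coboundary h) h01
    (t₀.isSupported_ind.add hc.1) fun x y hxy => by
      rw [cellSum_add, t₀.cellSum_ind hxy, hc.2, add_zero]
  exact ⟨t, by rw [heightDiff, ht, add_sub_cancel_left, hh.potential_coboundary]⟩

/-! ### Flips -/

lemma mem_horizontalPair {a b : ℤ} {d : Finset Cell} :
    d ∈ horizontalPair (a, b) ↔ d = hDomino a b ∨ d = hDomino a (b + 1) := by
  simp [horizontalPair, hDomino]

lemma mem_verticalPair {a b : ℤ} {d : Finset Cell} :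
    d ∈ verticalPair (a, b) ↔ d = vDomino a b ∨ d = vDomino (a + 1) b := by
  simp [verticalPair, vDomino]

lemma horizontalPair_subset {a b : ℤ} {D : Finset (Finset Cell)} :
    horizontalPair (a, b) ⊆ D ↔ hDomino a b ∈ D ∧ hDomino a (b + 1) ∈ D := by
  simp [horizontalPair, hDomino, Finset.insert_subset_iff]

lemma verticalPair_subset {a b : ℤ} {D : Finset (Finset Cell)} :
    verticalPair (a, b) ⊆ D ↔ vDomino a b ∈ D ∧ vDomino (a + 1) b ∈ D := by
  simp [verticalPair, vDomino, Finset.insert_subset_iff]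

lemma disjoint_horizontalPair_verticalPair (c : Cell) :
    Disjoint (horizontalPair c) (verticalPair c) := by
  obtain ⟨a, b⟩ := c
  rw [Finset.disjoint_left]
  intro d hH hV
  rcases mem_horizontalPair.1 hH with rfl | rfl <;>
    simp [mem_verticalPair, hDomino_ne_vDomino] at hV

lemma Tiling.notMem_of_mem_pairs (t : Tiling R) {c : Cell} {d d' : Finset Cell}
    (hd : d ∈ horizontalPair c) (hd' : d' ∈ verticalPair c) (h : d ∈ t.dominoes) :
    d' ∉ t.dominoes := by
  obtain ⟨a, b⟩ := c
  have hmeet : ∃ e, e ∈ d ∧ e ∈ d' := by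
    rcases mem_horizontalPair.1 hd with rfl | rfl <;>
      rcases mem_verticalPair.1 hd' with rfl | rfl <;>
      simp [mem_hDomino, mem_vDomino]
  obtain ⟨e, he, he'⟩ := hmeet
  intro h'
  rw [t.eq_of_mem h h' he he'] at hd
  exact Finset.disjoint_left.1 (disjoint_horizontalPair_verticalPair (a, b)) hd hd'

/-- The flip at the `2 × 2` square with lower left unit square `c`, replacing horizontal dominoes
by vertical ones; the two directions of this relation generate `flipGraph`. -/
def IsFlip (c : Cell) (t t' : Tiling R) : Prop :=
  horizontalPair c ⊆ t.dominoes ∧ verticalPair c ⊆ t'.dominoes ∧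
    t.dominoes \ horizontalPair c = t'.dominoes \ verticalPair c

/-- The change of the indicator function under the flip `IsFlip c`. -/
def flipIncrement (c : Cell) (d : Finset Cell) : ℤ :=
  (if d ∈ verticalPair c then 1 else 0) - (if d ∈ horizontalPair c then 1 else 0)

lemma isFlip_iff_ind_sub_ind {c : Cell} {t t' : Tiling R} :
    IsFlip c t t' ↔ t'.ind - t.ind = flipIncrement c := by
  have hdisj := Finset.disjoint_left.1 (disjoint_horizontalPair_verticalPair c)
  simp only [IsFlip, funext_iff, Finset.ext_iff, Finset.mem_sdiff, Finset.subset_iff, Pi.sub_apply,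
    Tiling.ind, flipIncrement]
  refine ⟨fun h d => ?_, fun h => ⟨fun d hd => ?_, fun d hd => ?_, fun d => ?_⟩⟩ <;> grind

lemma coboundary_single (a b k : ℤ) :
    coboundary (Pi.single (a + 1, b + 1) k : Vertex → ℤ) =
      -(colour (a, b) * k) • flipIncrement (a, b) := by
  funext d
  by_cases hd : IsDomino d
  · obtain ⟨x, y, rfl | rfl⟩ := isDomino_iff.1 hd
    · simp only [coboundary_hDomino, Pi.smul_apply, flipIncrement, mem_verticalPair,
        mem_horizontalPair, hDomino_ne_vDomino, hDomino_inj, Pi.single_apply, Prod.mk.injEq,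
        smul_eq_mul, Int.cast_id]
      have := colour_north a b
      grind
    · simp only [coboundary_vDomino, Pi.smul_apply, flipIncrement, mem_verticalPair,
        mem_horizontalPair, vDomino_ne_hDomino, vDomino_inj, Pi.single_apply, Prod.mk.injEq,
        smul_eq_mul, Int.cast_id]
      have := colour_east a b
      grind
  · have hV : d ∉ verticalPair (a, b) := fun h =>
      hd (isDomino_iff.2 (by rcases mem_verticalPair.1 h with rfl | rfl <;> exact ⟨_, _, .inr rfl⟩))
    have hH : d ∉ horizontalPair (a, b) := fun h => hd (isDomino_iff.2
      (by rcases mem_horizontalPair.1 h with rfl | rfl <;> exact ⟨_, _, .inl rfl⟩))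
    simp [coboundary_eq_zero_of_not_isDomino _ hd, flipIncrement, hV, hH]

lemma isInterior_add_one {a b : ℤ} : IsInterior R (a + 1, b + 1) ↔
    (a, b) ∈ R ∧ (a + 1, b) ∈ R ∧ (a, b + 1) ∈ R ∧ (a + 1, b + 1) ∈ R := by
  simp only [IsInterior, add_sub_cancel_right]
  tauto

lemma isInterior_of_horizontalPair_subset {t : Tiling R} {a b : ℤ}
    (h : horizontalPair (a, b) ⊆ t.dominoes) : IsInterior R (a + 1, b + 1) := by
  rw [horizontalPair_subset] at h
  have hlower := hDomino_subset.1 (t.subset _ h.1)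
  have hupper := hDomino_subset.1 (t.subset _ h.2)
  exact isInterior_add_one.2 ⟨hlower.1, hlower.2, hupper.1, hupper.2⟩

lemma isInterior_of_verticalPair_subset {t : Tiling R} {a b : ℤ}
    (h : verticalPair (a, b) ⊆ t.dominoes) : IsInterior R (a + 1, b + 1) := by
  rw [verticalPair_subset] at h
  have hleft := vDomino_subset.1 (t.subset _ h.1)
  have hright := vDomino_subset.1 (t.subset _ h.2)
  exact isInterior_add_one.2 ⟨hleft.1, hright.1, hleft.2, hright.2⟩

lemma vanishesOutside_single {A : Type*} [CommRing A] {v : Vertex} (hv : IsInterior R v) (k : A) :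
    VanishesOutside R (Pi.single v k : Vertex → A) := fun w hw => by
  have hne : w ≠ v := by rintro rfl; exact hw hv
  simp [hne]

lemma heightDiff_eq_single_iff {a b k : ℤ} (hv : IsInterior R (a + 1, b + 1)) {t t' : Tiling R} :
    heightDiff t' t = Pi.single (a + 1, b + 1) (-(colour (a, b) * k)) ↔
      t'.ind - t.ind = k • flipIncrement (a, b) := by
  have hcob : coboundary (Pi.single (a + 1, b + 1) (-(colour (a, b) * k)) : Vertex → ℤ) =
      k • flipIncrement (a, b) := by
    rw [coboundary_single, mul_neg, neg_neg, ← mul_assoc, colour_mul_self, one_mul]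
  rw [← hcob, ← coboundary_heightDiff]
  refine ⟨congrArg _, fun h => ?_⟩
  rw [← (vanishesOutside_single hv _).potential_coboundary, ← h, coboundary_heightDiff, heightDiff]

lemma isFlip_iff_heightDiff {a b : ℤ} {t t' : Tiling R} : IsFlip (a, b) t t' ↔
    IsInterior R (a + 1, b + 1) ∧
      heightDiff t' t = Pi.single (a + 1, b + 1) (-colour (a, b)) := by
  have key (hv : IsInterior R (a + 1, b + 1)) : IsFlip (a, b) t t' ↔
      heightDiff t' t = Pi.single (a + 1, b + 1) (-colour (a, b)) := by
    rw [isFlip_iff_ind_sub_ind, ← one_smul ℤ (flipIncrement (a, b)), ← heightDiff_eq_single_iff hv,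
      mul_one]
  refine ⟨fun h => ?_, fun h => (key h.1).2 h.2⟩
  have hv := isInterior_of_horizontalPair_subset h.1
  exact ⟨hv, (key hv).1 h⟩

lemma flipGraph_adj_iff {t t' : Tiling R} : (flipGraph R).Adj t t' ↔
    ∃ v, IsInterior R v ∧
      (heightDiff t' t = Pi.single v 1 ∨ heightDiff t' t = Pi.single v (-1)) := by
  have hrel : (flipGraph R).Adj t t' ↔ t ≠ t' ∧ ((∃ c, IsFlip c t t') ∨ ∃ c, IsFlip c t' t) :=
    SimpleGraph.fromRel_adj _ _ _
  rw [hrel]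
  constructor
  · rintro ⟨-, ⟨⟨a, b⟩, h⟩ | ⟨⟨a, b⟩, h⟩⟩ <;> obtain ⟨hv, h⟩ := isFlip_iff_heightDiff.1 h <;>
      refine ⟨_, hv, ?_⟩
    · rcases colour_eq_or (a, b) with hc | hc <;> simp [h, hc]
    · rw [heightDiff_swap, h, ← Pi.single_neg]
      rcases colour_eq_or (a, b) with hc | hc <;> simp [hc]
  · rintro ⟨⟨x, y⟩, hv, h⟩
    obtain ⟨a, rfl⟩ : ∃ a, x = a + 1 := ⟨x - 1, by ring⟩
    obtain ⟨b, rfl⟩ : ∃ b, y = b + 1 := ⟨y - 1, by ring⟩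
    refine ⟨?_, ?_⟩
    · rintro rfl
      rw [heightDiff_self] at h
      rcases h with h | h <;> simpa using congrFun h (a + 1, b + 1)
    · by_cases hc : heightDiff t' t = Pi.single (a + 1, b + 1) (-colour (a, b))
      · exact Or.inl ⟨_, isFlip_iff_heightDiff.2 ⟨hv, hc⟩⟩
      · refine Or.inr ⟨_, isFlip_iff_heightDiff.2 ⟨hv, ?_⟩⟩
        rw [heightDiff_swap]
        rcases h with h | h <;> rcases colour_eq_or (a, b) with h3 | h3 <;>
          simp_all [Pi.single_neg]

lemma SameBoundary.of_reachable {t t' : Tiling R} (h : (flipGraph R).Reachable t t') :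
    SameBoundary t t' := by
  obtain ⟨p⟩ := h
  induction p with
  | nil => exact SameBoundary.refl _
  | cons hadj _ ih =>
    refine SameBoundary.trans (SameBoundary.symm ?_) ih
    obtain ⟨v, hv, h | h⟩ := flipGraph_adj_iff.1 hadj <;> rw [SameBoundary, h] <;>
      exact vanishesOutside_single hv _

lemma exists_heightDiff_eq_single {a b : ℤ} (hv : IsInterior R (a + 1, b + 1)) (t : Tiling R)
    {k : ℤ} (h01 : ∀ d, t.ind d + k * flipIncrement (a, b) d = 0 ∨
      t.ind d + k * flipIncrement (a, b) d = 1) :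
    ∃ s : Tiling R, heightDiff s t = Pi.single (a + 1, b + 1) (-(colour (a, b) * k)) := by
  refine exists_tiling_of_height t (vanishesOutside_single hv _) fun d => ?_
  rw [coboundary_single, mul_neg, neg_neg, ← mul_assoc, colour_mul_self, one_mul]
  exact h01 d

lemma exists_flip_of_horizontalPair_subset {t : Tiling R} {a b : ℤ}
    (h : horizontalPair (a, b) ⊆ t.dominoes) :
    ∃ s : Tiling R, heightDiff s t = Pi.single (a + 1, b + 1) (-colour (a, b)) := by
  rw [← mul_one (colour (a, b))]
  refine exists_heightDiff_eq_single (isInterior_of_horizontalPair_subset h) t fun d => ?_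
  have hV : d ∈ verticalPair (a, b) → d ∉ t.dominoes := fun hd =>
    t.notMem_of_mem_pairs (mem_horizontalPair.2 (.inl rfl)) hd (horizontalPair_subset.1 h).1
  have := @h d
  grind [flipIncrement, Tiling.ind]

lemma exists_flip_of_verticalPair_subset {t : Tiling R} {a b : ℤ}
    (h : verticalPair (a, b) ⊆ t.dominoes) :
    ∃ s : Tiling R, heightDiff s t = Pi.single (a + 1, b + 1) (colour (a, b)) := by
  rw [← neg_neg (colour (a, b)), ← mul_neg_one (colour (a, b))]
  refine exists_heightDiff_eq_single (isInterior_of_verticalPair_subset h) t fun d => ?_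
  have hH : d ∈ horizontalPair (a, b) → d ∉ t.dominoes := fun hd hmem =>
    t.notMem_of_mem_pairs hd (mem_verticalPair.2 (.inl rfl)) hmem (verticalPair_subset.1 h).1
  have := @h d
  grind [flipIncrement, Tiling.ind]

/-! ### Existence of flips that decrease the height difference -/

/-- The grid edges that no domino of `t` crosses. -/
def Tiling.freeGraph (t : Tiling R) : SimpleGraph Vertex where
  Adj v w := gridGraph.Adj v w ∧ t.ind (edgeDomino v w) = 0
  symm := ⟨fun v w h => ⟨h.1.symm, by rw [edgeDomino_comm, h.2]⟩⟩
  loopless := ⟨fun _ h => gridGraph.irrefl h.1⟩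

lemma Tiling.freeGraph_adj_east {t : Tiling R} {x y : ℤ} :
    t.freeGraph.Adj (x, y) (x + 1, y) ↔ vDomino x (y - 1) ∉ t.dominoes := by
  rw [← Tiling.ind_eq_zero, ← edgeDomino_east]
  exact and_iff_right (gridGraph_adj_east x y)

lemma Tiling.freeGraph_adj_north {t : Tiling R} {x y : ℤ} :
    t.freeGraph.Adj (x, y) (x, y + 1) ↔ hDomino (x - 1) y ∉ t.dominoes := by
  rw [← Tiling.ind_eq_zero, ← edgeDomino_north]
  exact and_iff_right (gridGraph_adj_north x y)

lemma heightDiff_eq_iff {t t' : Tiling R} {v w : Vertex} (h : gridGraph.Adj v w) :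
    heightDiff t t' w = heightDiff t t' v ↔ t.ind (edgeDomino v w) = t'.ind (edgeDomino v w) := by
  rw [heightDiff_step t t' h]
  rcases colour_eq_or (leftCell v w) with hc | hc <;> rw [hc] <;> omega

lemma Tiling.freeGraph_adj_around_hDomino {t : Tiling R} {x y : ℤ} (h : hDomino x y ∈ t.dominoes) :
    t.freeGraph.Adj (x, y) (x + 1, y) ∧ t.freeGraph.Adj (x, y + 1) (x + 1, y + 1) ∧
      t.freeGraph.Adj (x, y) (x, y + 1) := by
  have huniq (d : Finset Cell) (hd : (x, y) ∈ d) (hne : d ≠ hDomino x y) : d ∉ t.dominoes :=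
    fun hmem => hne (t.eq_of_mem hmem h hd (mem_hDomino.2 (.inl rfl)))
  rw [freeGraph_adj_east, freeGraph_adj_east, freeGraph_adj_north, add_sub_cancel_right]
  exact ⟨huniq _ (by simp [mem_vDomino]) vDomino_ne_hDomino,
    huniq _ (by simp [mem_vDomino]) vDomino_ne_hDomino,
    huniq _ (by simp [mem_hDomino]) (by simp [hDomino_inj])⟩

lemma Tiling.hDomino_mem_of_freeGraph_adj {t : Tiling R} {x y : ℤ} (hR : (x + 1, y) ∈ R)
    (hsouth : t.freeGraph.Adj (x + 1, y) (x + 1 + 1, y))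
    (hnorth : t.freeGraph.Adj (x + 1, y + 1) (x + 1 + 1, y + 1))
    (heast : t.freeGraph.Adj (x + 1 + 1, y) (x + 1 + 1, y + 1)) : hDomino x y ∈ t.dominoes := by
  rw [freeGraph_adj_east] at hsouth hnorth
  rw [freeGraph_adj_north] at heast
  rw [add_sub_cancel_right] at hnorth heast
  obtain ⟨d, ⟨hd, hmem⟩, -⟩ := t.cover _ hR
  have := mem_dominoesAt.2 ⟨t.isDomino d hd, hmem⟩
  rw [dominoesAt, add_sub_cancel_right] at this
  grind

lemma heightDiff_eq_around_hDomino {t t' : Tiling R} {x y M : ℤ} (h : hDomino x y ∈ t.dominoes)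
    (hlower : heightDiff t t' (x + 1, y) = M) (hupper : heightDiff t t' (x + 1, y + 1) = M) :
    heightDiff t t' (x, y) = M ∧ heightDiff t t' (x, y + 1) = M := by
  have h' : hDomino x y ∈ t'.dominoes := by
    have hind := (heightDiff_eq_iff (gridGraph_adj_north _ _)).1 (hupper.trans hlower.symm)
    rw [edgeDomino_north, add_sub_cancel_right] at hind
    rwa [← Tiling.ind_eq_one, ← hind, Tiling.ind_eq_one]
  have hsame {v w : Vertex} (hvw : t.freeGraph.Adj v w) (hvw' : t'.freeGraph.Adj v w) :
      heightDiff t t' w = heightDiff t t' v :=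
    (heightDiff_eq_iff hvw.1).2 (hvw.2.trans hvw'.2.symm)
  obtain ⟨hsouth, hnorth, -⟩ := Tiling.freeGraph_adj_around_hDomino h
  obtain ⟨hsouth', hnorth', -⟩ := Tiling.freeGraph_adj_around_hDomino h'
  exact ⟨(hsame hsouth hsouth').symm.trans hlower, (hsame hnorth hnorth').symm.trans hupper⟩

section Staircase

variable {ι : Type*} {t t' : Tiling R} {h u : ι → ι} {p : ι → Vertex} {M : ℤ}

/-- A family of closed paths along edges not crossed by `t`, horizontal and vertical steps
alternating: `h i` and `u i` index the neighbours of the vertex `p i` along its horizontal and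
along its vertical edge. -/
structure IsStaircase (t : Tiling R) (h u : ι → ι) (p : ι → Vertex) : Prop where
  horizontal : ∀ i, t.freeGraph.Adj (p i) (p (h i)) ∧ (p i).2 = (p (h i)).2
  vertical : ∀ i, t.freeGraph.Adj (p i) (p (u i)) ∧ (p i).1 = (p (u i)).1

lemma forall_rel_update [DecidableEq ι] {α : Type*} {r : α → α → Prop}
    (hr : ∀ a b, r a b → r b a) (hh : Function.Involutive h) {p : ι → α}
    (hp : ∀ j, r (p j) (p (h j))) {i : ι} {a : α} (hi : h i ≠ i) (ha : r a (p (h i))) (j : ι) :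
    r (Function.update p i a j) (Function.update p i a (h j)) := by
  rcases eq_or_ne j i with rfl | hj
  · rwa [Function.update_self, Function.update_of_ne hi]
  rcases eq_or_ne (h j) i with rfl | hj'
  · rw [hh] at ha
    rw [Function.update_self, Function.update_of_ne hj]
    exact hr _ _ ha
  · rw [Function.update_of_ne hj, Function.update_of_ne hj']
    exact hp j

lemma IsStaircase.exists_corner [Finite ι] [Nonempty ι] (hp : IsStaircase t h u p) :
    ∃ i x y, p i = (x + 1 + 1, y + 1) ∧ p (h i) = (x + 1, y + 1) ∧ p (u i) = (x + 1 + 1, y) ∧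
      p (h (u i)) = (x + 1, y) := by
  obtain ⟨i, hmax⟩ := Finite.exists_max fun i => 2 * (p i).1 + (p i).2
  have west {v w : Vertex} (hvw : gridGraph.Adj v w) (hy : v.2 = w.2)
      (hlt : 2 * w.1 + w.2 < 2 * v.1 + v.2 + 2) : w.1 = v.1 - 1 := by
    induction hvw using gridGraph_adj_cases <;> dsimp only at * <;> omega
  have south {v w : Vertex} (hvw : gridGraph.Adj v w) (hx : v.1 = w.1)
      (hlt : 2 * w.1 + w.2 < 2 * v.1 + v.2 + 1) : w.2 = v.2 - 1 := by
    induction hvw using gridGraph_adj_cases <;> dsimp only at * <;> omega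
  obtain ⟨hadj, hy⟩ := hp.horizontal i
  obtain ⟨uadj, ux⟩ := hp.vertical i
  obtain ⟨huadj, huy⟩ := hp.horizontal (u i)
  have hx := west hadj.1 hy (by have := hmax (h i); omega)
  have uy := south uadj.1 ux (by have := hmax (u i); omega)
  have hux := west huadj.1 huy (by have := hmax (h (u i)); omega)
  refine ⟨i, (p i).1 - 2, (p i).2 - 1, ?_, ?_, ?_, ?_⟩ <;> ext <;> dsimp only <;> omega

lemma IsStaircase.hDomino_mem (hp : IsStaircase t h u p) {i : ι} {x y : ℤ}
    (hint : IsInterior R (p i)) (pi : p i = (x + 1 + 1, y + 1)) (phi : p (h i) = (x + 1, y + 1))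
    (pui : p (u i) = (x + 1 + 1, y)) (phui : p (h (u i)) = (x + 1, y)) :
    hDomino x y ∈ t.dominoes := by
  have heast := (hp.vertical i).1.symm
  have hnorth := (hp.horizontal i).1.symm
  have hsouth := (hp.horizontal (u i)).1.symm
  rw [pi] at hint
  rw [pi, pui] at heast
  rw [pi, phi] at hnorth
  rw [pui, phui] at hsouth
  exact Tiling.hDomino_mem_of_freeGraph_adj (isInterior_add_one.1 hint).1 hsouth hnorth heast

lemma IsStaircase.update_corner [DecidableEq ι] (hp : IsStaircase t h u p)
    (hh : Function.Involutive h) (hu : Function.Involutive u) {i : ι} {x y : ℤ}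
    (pi : p i = (x + 1 + 1, y + 1)) (phi : p (h i) = (x + 1, y + 1))
    (pui : p (u i) = (x + 1 + 1, y)) (phui : p (h (u i)) = (x + 1, y))
    (hmem : hDomino x y ∈ t.dominoes) :
    IsStaircase t h u (Function.update (Function.update p i (x, y + 1)) (u i) (x, y)) := by
  obtain ⟨hsouth, hnorth, hwest⟩ := Tiling.freeGraph_adj_around_hDomino hmem
  have hui : u i ≠ i := fun e => by simp [e, pi] at pui
  have hhi : h i ≠ i := fun e => by simp [e, pi] at phi
  have hhui : h (u i) ≠ i := fun e => by simp [e, pi] at phui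
  have hhui' : h (u i) ≠ u i := fun e => by simp [e, pui] at phui
  constructor
  · have hsymm (v w : Vertex) (hvw : t.freeGraph.Adj v w ∧ v.2 = w.2) :
        t.freeGraph.Adj w v ∧ w.2 = v.2 := ⟨hvw.1.symm, hvw.2.symm⟩
    refine forall_rel_update hsymm hh (forall_rel_update hsymm hh hp.horizontal hhi ?_) hhui' ?_
    · rw [phi]
      exact ⟨hnorth, rfl⟩
    · rw [Function.update_of_ne hhui, phui]
      exact ⟨hsouth, rfl⟩
  · intro j
    rcases eq_or_ne j i with rfl | hj
    · rw [Function.update_of_ne hui.symm, Function.update_self, Function.update_self]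
      exact ⟨hwest.symm, rfl⟩
    rcases eq_or_ne j (u i) with rfl | hj'
    · rw [hu, Function.update_of_ne hui.symm, Function.update_self, Function.update_self]
      exact ⟨hwest, rfl⟩
    · have huj : u j ≠ i := fun e => hj' (by rw [← e, hu])
      rw [Function.update_of_ne hj', Function.update_of_ne hj,
        Function.update_of_ne (hu.injective.ne hj), Function.update_of_ne huj]
      exact hp.vertical j

lemma IsStaircase.exists_sum_lt [Fintype ι] [Nonempty ι] (hp : IsStaircase t h u p)
    (hh : Function.Involutive h) (hu : Function.Involutive u)
    (hR : ∀ v, heightDiff t t' v = M → IsInterior R v) (hM : ∀ i, heightDiff t t' (p i) = M) :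
    ∃ q : ι → Vertex, IsStaircase t h u q ∧ (∀ i, heightDiff t t' (q i) = M) ∧
      ∑ i, (2 * (q i).1 + (q i).2) < ∑ i, (2 * (p i).1 + (p i).2) := by
  classical
  obtain ⟨i, x, y, pi, phi, pui, phui⟩ := hp.exists_corner
  have hmem := hp.hDomino_mem (hR _ (hM i)) pi phi pui phui
  obtain ⟨hlower, hupper⟩ := heightDiff_eq_around_hDomino hmem (phui ▸ hM _) (phi ▸ hM _)
  have hle : ∀ j, 2 * (Function.update (Function.update p i (x, y + 1)) (u i) (x, y) j).1 +
      (Function.update (Function.update p i (x, y + 1)) (u i) (x, y) j).2 ≤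
        2 * (p j).1 + (p j).2 := by
    refine (Function.forall_update_iff _
      fun j (v : Vertex) => 2 * v.1 + v.2 ≤ 2 * (p j).1 + (p j).2).2 ⟨?_, fun j _ => ?_⟩
    · rw [pui]
      dsimp only
      omega
    · refine (Function.forall_update_iff p
        fun j (v : Vertex) => 2 * v.1 + v.2 ≤ 2 * (p j).1 + (p j).2).2 ⟨?_, fun _ _ => le_rfl⟩ j
      rw [pi]
      dsimp only
      omega
  refine ⟨_, hp.update_corner hh hu pi phi pui phui hmem, ?_,
    Finset.sum_lt_sum (fun j _ => hle j) ⟨u i, Finset.mem_univ _, ?_⟩⟩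
  · refine (Function.forall_update_iff _ fun _ v => heightDiff t t' v = M).2 ⟨hlower, fun j _ => ?_⟩
    exact (Function.forall_update_iff p fun _ v => heightDiff t t' v = M).2
      ⟨hupper, fun j _ => hM j⟩ j
  · rw [Function.update_self, pui]
    dsimp only
    omega

lemma not_isStaircase [Finite ι] [Nonempty ι] (hh : Function.Involutive h)
    (hu : Function.Involutive u) (hR : ∀ v, heightDiff t t' v = M → IsInterior R v)
    (hM : ∀ i, heightDiff t t' (p i) = M) : ¬ IsStaircase t h u p := by
  intro hp
  cases nonempty_fintype ι
  have hfin : {p | IsStaircase t h u p ∧ ∀ i, heightDiff t t' (p i) = M}.Finite :=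
    (Set.Finite.pi' fun _ : ι => R.finite_toSet).subset fun p hp i => (hR _ (hp.2 i)).1
  obtain ⟨p₀, ⟨hp₀, hM₀⟩, hmin⟩ :=
    Set.exists_min_image _ (fun p => ∑ i, (2 * (p i).1 + (p i).2)) hfin ⟨p, hp, hM⟩
  obtain ⟨q, hq, hqM, hlt⟩ := hp₀.exists_sum_lt hh hu hR hM₀
  exact (hmin q ⟨hq, hqM⟩).not_gt hlt

open scoped Classical in
/-- Along the cycles of `σ`, which alternate between `P` and its negation, the involution that
exchanges each `i` satisfying `P` with `σ i`. -/
noncomputable def cyclePartner (σ : Equiv.Perm ι) (P : ι → Prop) (i : ι) : ι :=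
  if P i then σ i else σ.symm i

lemma cyclePartner_involutive {σ : Equiv.Perm ι} {P : ι → Prop} (hP : ∀ i, P (σ i) ↔ ¬ P i) :
    Function.Involutive (cyclePartner σ P) := by
  intro i
  have hsymm : P (σ.symm i) ↔ ¬ P i := by
    rw [← not_iff_not, ← hP, σ.apply_symm_apply, not_not]
  by_cases hi : P i <;> simp [cyclePartner, hi, hP, hsymm]

lemma isStaircase_cyclePartner {σ : Equiv.Perm ι}
    (hadj : ∀ i, t.freeGraph.Adj (p i) (p (σ i)))
    (hcol : ∀ i, colour (p (σ i)) = -colour (p i))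
    (hwhite : ∀ i, colour (p i) = -1 → (p i).2 = (p (σ i)).2)
    (hblack : ∀ i, colour (p i) = 1 → (p i).1 = (p (σ i)).1) :
    IsStaircase t (cyclePartner σ fun i => colour (p i) = -1)
      (cyclePartner σ fun i => colour (p i) = 1) p := by
  constructor
  all_goals
    intro i
    have hadj' := hadj (σ.symm i)
    have hcol' := hcol (σ.symm i)
    have hwhite' := hwhite (σ.symm i)
    have hblack' := hblack (σ.symm i)
    rw [σ.apply_symm_apply] at hadj' hcol' hwhite' hblack'
    rcases colour_eq_or (p i) with hi | hi
  · simpa [cyclePartner, hi] using ⟨hadj'.symm, (hwhite' (by omega)).symm⟩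
  · simpa [cyclePartner, hi] using ⟨hadj i, hwhite i hi⟩
  · simpa [cyclePartner, hi] using ⟨hadj i, hblack i hi⟩
  · simpa [cyclePartner, hi] using ⟨hadj'.symm, (hblack' (by omega)).symm⟩

lemma not_forall_perm_adj [Finite ι] [Nonempty ι] (σ : Equiv.Perm ι)
    (hR : ∀ v, heightDiff t t' v = M → IsInterior R v) (hM : ∀ i, heightDiff t t' (p i) = M)
    (hcol : ∀ i, colour (p (σ i)) = -colour (p i))
    (hwhite : ∀ i, colour (p i) = -1 → (p i).2 = (p (σ i)).2)
    (hblack : ∀ i, colour (p i) = 1 → (p i).1 = (p (σ i)).1) :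
    ¬ ∀ i, t.freeGraph.Adj (p i) (p (σ i)) := by
  intro hadj
  refine not_isStaircase (cyclePartner_involutive fun i => ?_) (cyclePartner_involutive fun i => ?_)
    hR hM (isStaircase_cyclePartner hadj hcol hwhite hblack)
  all_goals
    rw [hcol]
    rcases colour_eq_or (p i) with hi | hi <;> rw [hi] <;> norm_num

end Staircase

lemma exists_nonempty_bijOn {α : Type*} [Finite α] [Nonempty α] (f : α → α) :
    ∃ s : Set α, s.Nonempty ∧ Set.BijOn f s s := by
  refine ⟨Function.periodicPts f, ?_, Function.bijOn_periodicPts f⟩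
  obtain ⟨a⟩ := ‹Nonempty α›
  obtain ⟨m, n, hmn, heq⟩ := Finite.exists_ne_map_eq_of_infinite fun n => f^[n] a
  wlog hlt : m < n generalizing m n
  · exact this n m hmn.symm heq.symm (hmn.lt_or_gt.resolve_left hlt)
  refine ⟨f^[m] a, Function.mk_mem_periodicPts (Nat.sub_pos_of_lt hlt) ?_⟩
  rw [Function.IsPeriodicPt, Function.IsFixedPt, ← Function.iterate_add_apply,
    Nat.sub_add_cancel hlt.le]
  exact heq.symm

lemma freeGraph_adj_of_leftCell_white {t t' : Tiling R} {v w : Vertex}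
    (hle : heightDiff t t' w ≤ heightDiff t t' v) (hvw : gridGraph.Adj v w)
    (hfree : edgeDomino v w ∉ t.dominoes) (hcol : colour (leftCell v w) = -1) :
    t.freeGraph.Adj v w ∧ heightDiff t t' w = heightDiff t t' v := by
  have hind := Tiling.ind_eq_zero.2 hfree
  have hw := heightDiff_step t t' hvw
  rw [hcol, hind] at hw
  have := t'.ind_eq_or (edgeDomino v w)
  exact ⟨⟨hvw, hind⟩, by omega⟩

lemma exists_freeGraph_adj_of_forall_ne {t t' : Tiling R} {v : Vertex}
    (hle : ∀ w, heightDiff t t' w ≤ heightDiff t t' v)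
    (hflip : ∀ s : Tiling R, heightDiff s t ≠ Pi.single v (-1)) :
    ∃ w, t.freeGraph.Adj v w ∧ heightDiff t t' w = heightDiff t t' v ∧ colour w = -colour v ∧
      (colour v = -1 → v.2 = w.2) ∧ (colour v = 1 → v.1 = w.1) := by
  obtain ⟨x, y⟩ := v
  obtain ⟨a, rfl⟩ : ∃ a, x = a + 1 := ⟨x - 1, by ring⟩
  obtain ⟨b, rfl⟩ : ∃ b, y = b + 1 := ⟨y - 1, by ring⟩
  have hright : colour (a + 1, b) = -colour (a + 1, b + 1) := by rw [colour_north, neg_neg]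
  have hupper : colour (a, b + 1) = -colour (a + 1, b + 1) := by rw [colour_east, neg_neg]
  have hab : colour (a, b) = colour (a + 1, b + 1) := by rw [colour_east, colour_north, neg_neg]
  rcases colour_eq_or (a + 1, b + 1) with hc | hc
  · have hpair : ¬ (hDomino a b ∈ t.dominoes ∧ hDomino a (b + 1) ∈ t.dominoes) := fun hmem => by
      obtain ⟨s, hs⟩ := exists_flip_of_horizontalPair_subset (horizontalPair_subset.2 hmem)
      exact hflip s (by rw [hs, hab, hc])
    rcases not_and_or.1 hpair with hfree | hfree
    · obtain ⟨hadj, heq⟩ := freeGraph_adj_of_leftCell_white (hle _)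
        (gridGraph_adj_north (a + 1) b).symm
        (by rwa [edgeDomino_comm, edgeDomino_north, add_sub_cancel_right])
        (by rw [leftCell_south, hright, hc])
      exact ⟨_, hadj, heq, hright, by simp [hc], by simp⟩
    · obtain ⟨hadj, heq⟩ := freeGraph_adj_of_leftCell_white (hle _)
        (gridGraph_adj_north (a + 1) (b + 1))
        (by rwa [edgeDomino_north, add_sub_cancel_right])
        (by rw [leftCell_north, add_sub_cancel_right, hupper, hc])
      exact ⟨_, hadj, heq, colour_north _ _, by simp [hc], by simp⟩
  · have hpair : ¬ (vDomino a b ∈ t.dominoes ∧ vDomino (a + 1) b ∈ t.dominoes) := fun hmem => by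
      obtain ⟨s, hs⟩ := exists_flip_of_verticalPair_subset (verticalPair_subset.2 hmem)
      exact hflip s (by rw [hs, hab, hc])
    rcases not_and_or.1 hpair with hfree | hfree
    · obtain ⟨hadj, heq⟩ := freeGraph_adj_of_leftCell_white (hle _)
        (gridGraph_adj_east a (b + 1)).symm
        (by rwa [edgeDomino_comm, edgeDomino_east, add_sub_cancel_right])
        (by rw [leftCell_west, add_sub_cancel_right, hab, hc])
      exact ⟨_, hadj, heq, hupper, by simp, by simp [hc]⟩
    · obtain ⟨hadj, heq⟩ := freeGraph_adj_of_leftCell_white (hle _)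
        (gridGraph_adj_east (a + 1) (b + 1))
        (by rwa [edgeDomino_east, add_sub_cancel_right])
        (by rw [leftCell_east, hc])
      exact ⟨_, hadj, heq, colour_east _ _, by simp, by simp [hc]⟩

lemma exists_flip_at_max {t t' : Tiling R} (hbd : SameBoundary t t') {M : ℤ} (hM : M ≠ 0)
    (hle : ∀ v, heightDiff t t' v ≤ M) (hmax : ∃ v, heightDiff t t' v = M) :
    ∃ v, heightDiff t t' v = M ∧ ∃ s : Tiling R, heightDiff s t = Pi.single v (-1) := by
  by_contra! hflip
  have hR (v : Vertex) (hv : heightDiff t t' v = M) : IsInterior R v := by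
    by_contra hint
    exact hM (hv.symm.trans (hbd v hint))
  have : Finite {v // heightDiff t t' v = M} :=
    (R.finite_toSet.subset fun v hv => (hR v hv).1).to_subtype
  have : Nonempty {v // heightDiff t t' v = M} := nonempty_subtype.2 hmax
  choose next hadj hnext hcol hhor hver using fun v : {v // heightDiff t t' v = M} =>
    exists_freeGraph_adj_of_forall_ne (fun w => (hle w).trans_eq v.2.symm) (hflip v v.2)
  let f (v : {v // heightDiff t t' v = M}) : {v // heightDiff t t' v = M} :=
    ⟨next v, (hnext v).trans v.2⟩
  obtain ⟨s, ⟨v₀, hv₀⟩, hbij⟩ := exists_nonempty_bijOn f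
  have : Nonempty s := ⟨v₀, hv₀⟩
  exact not_forall_perm_adj (p := fun i : s => i.1.1) (hbij.equiv f) hR (fun i => i.1.2)
    (fun i => hcol i) (fun i => hhor i) (fun i => hver i) fun i => hadj i

/-! ### Distances in the flip graph -/

/-- The `ℓ¹`-distance of the height functions of two tilings, in units of `4`. -/
def heightDist (t t' : Tiling R) : ℕ := ∑ v ∈ R, (heightDiff t t' v).natAbs

lemma heightDist_self (t : Tiling R) : heightDist t t = 0 := by
  simp [heightDist, heightDiff_self]

lemma heightDist_comm (t t' : Tiling R) : heightDist t t' = heightDist t' t := by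
  simp [heightDist, heightDiff_swap t t']

lemma heightDist_triangle (t t' t'' : Tiling R) :
    heightDist t t'' ≤ heightDist t t' + heightDist t' t'' := by
  simp only [heightDist, ← Finset.sum_add_distrib, ← heightDiff_add_apply t t' t'']
  exact Finset.sum_le_sum fun v _ => Int.natAbs_add_le _ _

lemma heightDist_of_adj {t t' : Tiling R} (h : (flipGraph R).Adj t t') : heightDist t t' = 1 := by
  rw [heightDist_comm, heightDist]
  obtain ⟨v, hv, h | h⟩ := flipGraph_adj_iff.1 h
  all_goals
    rw [h, Finset.sum_eq_single_of_mem v hv.1 fun w _ hw => by simp [hw]]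
    simp

lemma heightDist_le_length {t t' : Tiling R} (p : (flipGraph R).Walk t t') :
    heightDist t t' ≤ p.length := by
  induction p with
  | nil => rw [heightDist_self, SimpleGraph.Walk.length_nil]
  | @cons t₁ t₂ t₃ hadj p ih =>
    have := heightDist_triangle t₁ t₂ t₃
    rw [heightDist_of_adj hadj] at this
    rw [SimpleGraph.Walk.length_cons]
    omega

lemma heightDist_add_one {s t t' : Tiling R} {u : Vertex} (hu : u ∈ R)
    (hpos : 0 < heightDiff t t' u) (hs : heightDiff s t = Pi.single u (-1)) :
    heightDist s t' + 1 = heightDist t t' := by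
  have hterm (v : Vertex) : (heightDiff s t' v).natAbs + (if v = u then 1 else 0) =
      (heightDiff t t' v).natAbs := by
    rw [← heightDiff_add_apply s t t', hs]
    rcases eq_or_ne v u with rfl | hv
    · rw [Pi.single_eq_same, if_pos rfl]
      omega
    · rw [Pi.single_eq_of_ne hv, if_neg hv, zero_add, add_zero]
  simp only [heightDist, ← hterm, Finset.sum_add_distrib, Finset.sum_ite_eq', if_pos hu]

lemma SameBoundary.exists_adj {t t' : Tiling R} (hbd : SameBoundary t t') {v : Vertex}
    (hv : 0 < heightDiff t t' v) :
    ∃ s, (flipGraph R).Adj t s ∧ heightDist s t' + 1 = heightDist t t' := by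
  have hint (v : Vertex) (hv : 0 < heightDiff t t' v) : IsInterior R v := by
    by_contra h
    exact hv.ne' (hbd v h)
  obtain ⟨w, -, hmax⟩ := R.exists_max_image (heightDiff t t') ⟨v, (hint v hv).1⟩
  have hpos : 0 < heightDiff t t' w := hv.trans_le (hmax v (hint v hv).1)
  have hle (u : Vertex) : heightDiff t t' u ≤ heightDiff t t' w := by
    by_cases hu : 0 < heightDiff t t' u
    · exact hmax u (hint u hu).1
    · omega
  obtain ⟨u, hu, s, hs⟩ := exists_flip_at_max hbd hpos.ne' hle ⟨w, rfl⟩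
  have hupos : 0 < heightDiff t t' u := by omega
  exact ⟨s, flipGraph_adj_iff.2 ⟨u, hint u hupos, .inr hs⟩,
    heightDist_add_one (hint u hupos).1 hupos hs⟩

lemma SameBoundary.exists_walk {t t' : Tiling R} (hbd : SameBoundary t t') :
    ∃ p : (flipGraph R).Walk t t', p.length = heightDist t t' := by
  induction hn : heightDist t t' using Nat.strong_induction_on generalizing t t' with
  | _ n ih =>
    by_cases h0 : heightDiff t t' = 0
    · obtain rfl := eq_of_heightDiff_eq_zero h0
      exact ⟨.nil, by rw [← hn, heightDist_self, SimpleGraph.Walk.length_nil]⟩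
    obtain ⟨v, hv⟩ := Function.ne_iff.1 h0
    rw [Pi.zero_apply] at hv
    wlog hpos : 0 < heightDiff t t' v generalizing t t'
    · have hswap := congrFun (heightDiff_swap t t') v
      rw [Pi.neg_apply] at hswap
      obtain ⟨p, hp⟩ := this hbd.symm (by rw [heightDist_comm, hn])
        (fun h => hv (by rw [heightDiff_swap t' t, h, neg_zero, Pi.zero_apply]))
        (by omega) (by omega)
      exact ⟨p.reverse, by rw [SimpleGraph.Walk.length_reverse, hp]⟩
    obtain ⟨s, hadj, hdist⟩ := hbd.exists_adj hpos
    obtain ⟨p, hp⟩ := ih (heightDist s t') (by omega)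
      ((SameBoundary.of_reachable hadj.reachable).symm.trans hbd) rfl
    exact ⟨.cons hadj p, by rw [SimpleGraph.Walk.length_cons]; omega⟩

lemma reachable_iff_sameBoundary {t t' : Tiling R} :
    (flipGraph R).Reachable t t' ↔ SameBoundary t t' :=
  ⟨SameBoundary.of_reachable, fun h => ⟨h.exists_walk.choose⟩⟩

lemma SameBoundary.dist_eq {t t' : Tiling R} (hbd : SameBoundary t t') :
    (flipGraph R).dist t t' = heightDist t t' := by
  obtain ⟨p, hp⟩ := hbd.exists_walk
  obtain ⟨q, hq⟩ := (reachable_iff_sameBoundary.2 hbd).exists_walk_length_eq_dist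
  exact le_antisymm (hp ▸ SimpleGraph.dist_le p) (hq ▸ heightDist_le_length q)

/-! ### Flows across cuts -/

lemma Tiling.flow_cons (t : Tiling R) {u v w : Vertex} (h : (edgeGraph R).Adj u v)
    (p : (edgeGraph R).Walk v w) :
    t.flow (.cons h p) = colour (leftCell u v) * t.ind (edgeDomino u v) + t.flow p := by
  have hterm : (if t.Crosses u v then colour (leftCell u v) else 0) =
      colour (leftCell u v) * t.ind (edgeDomino u v) := by
    rcases t.ind_eq_or (edgeDomino u v) with h' | h' <;> simp [Tiling.crosses_iff, h']
  rw [← hterm]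
  simp [Tiling.flow]

lemma flow_sub_flow (t t' : Tiling R) {u v : Vertex} (p : (edgeGraph R).Walk u v) :
    t.flow p - t'.flow p = heightDiff t t' v - heightDiff t t' u := by
  induction p with
  | nil => simp [Tiling.flow]
  | cons h p ih =>
    rw [Tiling.flow_cons, Tiling.flow_cons]
    linear_combination ih - heightDiff_step t t' h.1

lemma IsBoundaryVertex.not_isInterior {v : Vertex} (h : IsBoundaryVertex R v) :
    ¬ IsInterior R v := by
  obtain ⟨w, hvw, hxor⟩ := h
  induction hvw using gridGraph_adj_cases
  all_goals
    simp only [leftCell_east, leftCell_west, leftCell_north, leftCell_south, xor_def] at hxor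
    simp only [IsInterior, add_sub_cancel_right]
    tauto

lemma isBoundaryVertex_of_adj {v w : Vertex} (h : (edgeGraph R).Adj v w) (hv : ¬ IsInterior R v) :
    IsBoundaryVertex R v := by
  by_contra hb
  have hiff (w : Vertex) (hvw : gridGraph.Adj v w) : leftCell v w ∈ R ↔ leftCell w v ∈ R :=
    not_xor _ _ |>.1 fun hxor => hb ⟨w, hvw, hxor⟩
  have hnone : (v.1, v.2) ∉ R ∧ (v.1 - 1, v.2) ∉ R ∧ (v.1, v.2 - 1) ∉ R ∧
      (v.1 - 1, v.2 - 1) ∉ R := by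
    obtain ⟨x, y⟩ := v
    obtain ⟨a, rfl⟩ : ∃ a, x = a + 1 := ⟨x - 1, by ring⟩
    obtain ⟨b, rfl⟩ : ∃ b, y = b + 1 := ⟨y - 1, by ring⟩
    have heast := hiff _ (gridGraph_adj_east _ _)
    have hnorth := hiff _ (gridGraph_adj_north _ _)
    have hwest := hiff _ (gridGraph_adj_east _ _).symm
    have hsouth := hiff _ (gridGraph_adj_north _ _).symm
    simp only [leftCell_east, leftCell_west, leftCell_north, leftCell_south, IsInterior,
      add_sub_cancel_right] at *
    tauto
  obtain ⟨hvw, hR⟩ := h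
  clear hb hiff hv
  induction hvw using gridGraph_adj_cases <;>
    simp only [leftCell_east, leftCell_west, leftCell_north, leftCell_south,
      add_sub_cancel_right] at hR hnone <;>
    tauto

lemma heightDiff_eq_of_boundaryGraph_reachable (t t' : Tiling R) {u v : Vertex}
    (h : (boundaryGraph R).Reachable u v) : heightDiff t t' u = heightDiff t t' v := by
  obtain ⟨p⟩ := h
  induction p with
  | nil => rfl
  | cons hadj _ ih =>
    have hcells := (xor_iff_or_and_not_and _ _).1 hadj.2
    rw [← ih, heightDiff_step t t' hadj.1, t.ind_edgeDomino_eq_zero hcells.2,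
      t'.ind_edgeDomino_eq_zero hcells.2, sub_self, mul_zero, add_zero]

section Flow

variable {t t' : Tiling R}
  (hflow : ∀ (u v : Vertex) (p : (edgeGraph R).Walk u v), IsCut p → t.flow p = t'.flow p)

include hflow

lemma heightDiff_eq_of_flow_eq {u v : Vertex} (hu : ¬ IsInterior R u) (hv : ¬ IsInterior R v)
    (huv : (edgeGraph R).Reachable u v) : heightDiff t t' u = heightDiff t t' v := by
  by_cases hb : (boundaryGraph R).Reachable u v
  · exact heightDiff_eq_of_boundaryGraph_reachable t t' hb
  have isBoundaryVertex {u v : Vertex} (hu : ¬ IsInterior R u) (hne : u ≠ v)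
      (huv : (edgeGraph R).Reachable u v) : IsBoundaryVertex R u := by
    obtain ⟨_ | ⟨hadj, _⟩⟩ := huv
    · exact absurd rfl hne
    · exact isBoundaryVertex_of_adj hadj hu
  have hne : u ≠ v := fun e => hb (e ▸ .refl _)
  obtain ⟨p, hp⟩ := huv.exists_isPath
  have hcut : IsCut p :=
    ⟨hp, isBoundaryVertex hu hne huv, isBoundaryVertex hv hne.symm huv.symm, hb⟩
  linear_combination flow_sub_flow t t' p - hflow u v p hcut

lemma exists_reachable_of_flow_eq (v : Vertex) :
    ∃ u, ¬ IsInterior R u ∧ heightDiff t t' u = 0 ∧ (edgeGraph R).Reachable v u := by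
  obtain ⟨x, y⟩ := v
  induction x using west_induction R with
  | base x hx =>
    refine ⟨_, fun hint => ?_, potential_eq_zero_of_west _ hx, .refl _⟩
    have := hx _ hint.2.1
    dsimp only at this
    omega
  | step x ih =>
    obtain ⟨u, hu, hu0, hreach⟩ := ih
    by_cases hedge : (edgeGraph R).Adj (x, y) (x + 1, y)
    · exact ⟨u, hu, hu0, hedge.symm.reachable.trans hreach⟩
    have hcell : (x, y) ∉ R := fun h =>
      hedge ⟨gridGraph_adj_east x y, .inl (by rwa [leftCell_east])⟩
    have hfree (s : Tiling R) : s.ind (edgeDomino (x, y) (x + 1, y)) = 0 :=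
      s.ind_edgeDomino_eq_zero fun h => hedge ⟨gridGraph_adj_east x y, .inl h.1⟩
    have hint : ¬ IsInterior R (x + 1, y) := fun h => hcell (by simpa using h.2.1)
    refine ⟨_, hint, ?_, .refl _⟩
    rw [heightDiff_step t t' (gridGraph_adj_east x y), hfree, hfree, sub_self, mul_zero, add_zero,
      heightDiff_eq_of_flow_eq hflow (fun h => hcell h.1) hu hreach, hu0]

lemma sameBoundary_of_flow_eq : SameBoundary t t' := by
  intro v hv
  obtain ⟨u, hu, hu0, hreach⟩ := exists_reachable_of_flow_eq hflow v
  rw [heightDiff_eq_of_flow_eq hflow hv hu hreach, hu0]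

end Flow

lemma sameBoundary_iff_flow_eq {t t' : Tiling R} : SameBoundary t t' ↔
    ∀ (u v : Vertex) (p : (edgeGraph R).Walk u v), IsCut p → t.flow p = t'.flow p := by
  refine ⟨fun h u v p hp => ?_, sameBoundary_of_flow_eq⟩
  have := flow_sub_flow t t' p
  rw [h v hp.2.2.1.not_isInterior, h u hp.2.1.not_isInterior] at this
  omega

/-! ### Height sections -/

/-- The height bundle in which the zero section is a height section of the tiling `t`. -/
def Tiling.bundle (t : Tiling R) : HeightBundle R where
  shift v w := -(colour (leftCell v w) * (1 - 4 * t.ind (edgeDomino v w)))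
  shift_symm v w h := by
    rw [edgeDomino_comm, colour_leftCell_swap h.1]
    ring
  flat := by
    rintro ⟨x, y⟩ hc
    have hsum := t.cellSum_ind hc
    rw [cellSum_eq] at hsum
    simp only [Prod.mk_add_mk, add_zero]
    rw [edgeDomino_comm (x, y + 1) (x + 1, y + 1), edgeDomino_comm (x, y) (x, y + 1),
      edgeDomino_east, edgeDomino_east, edgeDomino_north, edgeDomino_north, leftCell_east,
      leftCell_west, leftCell_north, leftCell_south]
    simp only [add_sub_cancel_right]
    linear_combination (4 * colour (x, y)) * hsum

lemma Tiling.isHeightSection_bundle (t₀ t : Tiling R) :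
    IsHeightSection t₀.bundle t fun v => -4 * heightDiff t t₀ v := by
  intro v w h hcross
  have hstep := heightDiff_step t t₀ h.1
  rw [show t.ind (edgeDomino v w) = 0 from Tiling.ind_eq_zero.2 hcross] at hstep
  simp only [Tiling.bundle]
  linear_combination (-4) * hstep

lemma exists_bundle_sections (R : Finset Cell) :
    ∃ (L : HeightBundle R) (θ : Tiling R → Vertex → ℤ), (∀ t, IsHeightSection L t (θ t)) ∧
      ∀ t₁ t₂, (flipGraph R).Reachable t₁ t₂ → ∀ v, IsBoundaryVertex R v → θ t₁ v = θ t₂ v := by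
  rcases isEmpty_or_nonempty (Tiling R) with hempty | ⟨⟨t₀⟩⟩
  · exact ⟨⟨fun _ _ => 0, by simp, by simp⟩, fun _ _ => 0, hempty.elim, hempty.elim⟩
  refine ⟨t₀.bundle, fun t v => -4 * heightDiff t t₀ v, t₀.isHeightSection_bundle, ?_⟩
  intro t₁ t₂ h v hv
  have hv0 := reachable_iff_sameBoundary.1 h v hv.not_isInterior
  simp only [← heightDiff_add_apply t₁ t₂ t₀ v, hv0, zero_add]

namespace IsHeightSection

variable {L : HeightBundle R} {t : Tiling R} {θ : Vertex → ℤ}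

lemma step_around_cell (hθ : IsHeightSection L t θ) {x y : ℤ} (hc : (x, y) ∈ R) :
    θ (x + 1, y) = θ (x, y) + L.shift (x, y) (x + 1, y) +
        colour (x, y) * (1 - 4 * t.ind (vDomino x (y - 1))) ∧
      θ (x + 1, y + 1) = θ (x + 1, y) + L.shift (x + 1, y) (x + 1, y + 1) +
        colour (x, y) * (1 - 4 * t.ind (hDomino x y)) ∧
      θ (x, y + 1) = θ (x + 1, y + 1) + L.shift (x + 1, y + 1) (x, y + 1) +
        colour (x, y) * (1 - 4 * t.ind (vDomino x y)) ∧
      θ (x, y) = θ (x, y + 1) + L.shift (x, y + 1) (x, y) +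
        colour (x, y) * (1 - 4 * t.ind (hDomino (x - 1) y)) := by
  have hflat := L.flat (x, y) hc
  have hsum := t.cellSum_ind hc
  simp only [Prod.mk_add_mk, add_zero] at hflat
  rw [cellSum_eq] at hsum
  have free {v w : Vertex} (hvw : gridGraph.Adj v w) (hleft : leftCell v w = (x, y))
      (h : t.ind (edgeDomino v w) = 0) : θ w = θ v + L.shift v w + colour (x, y) :=
    hleft ▸ hθ v w ⟨hvw, .inl (hleft ▸ hc)⟩ (Tiling.ind_eq_zero.1 h)
  have hsouth := free (gridGraph_adj_east x y) (leftCell_east x y)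
  have heast := free (gridGraph_adj_north (x + 1) y) (by rw [leftCell_north, add_sub_cancel_right])
  have hnorth := free (gridGraph_adj_east x (y + 1)).symm
    (by rw [leftCell_west, add_sub_cancel_right])
  have hwest := free (gridGraph_adj_north x y).symm (leftCell_south x y)
  rw [edgeDomino_comm] at hnorth hwest
  rw [edgeDomino_east] at hsouth hnorth
  rw [edgeDomino_north] at heast hwest
  rw [add_sub_cancel_right] at heast hnorth
  rcases t.ind_eq_or (vDomino x (y - 1)) with h₁ | h₁ <;>
  rcases t.ind_eq_or (hDomino x y) with h₂ | h₂ <;>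
  rcases t.ind_eq_or (vDomino x y) with h₃ | h₃ <;>
  rcases t.ind_eq_or (hDomino (x - 1) y) with h₄ | h₄ <;>
  simp only [h₁, h₂, h₃, h₄, true_implies, mul_zero, mul_one, sub_zero]
    at hsum hsouth heast hnorth hwest ⊢ <;>
  omega

lemma step_of_left (hθ : IsHeightSection L t θ) {v w : Vertex} (hvw : gridGraph.Adj v w)
    (hleft : leftCell v w ∈ R) :
    θ w = θ v + L.shift v w + colour (leftCell v w) * (1 - 4 * t.ind (edgeDomino v w)) := by
  induction hvw using gridGraph_adj_cases with
  | east x y =>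
    rw [leftCell_east] at hleft ⊢
    rw [edgeDomino_east]
    exact (hθ.step_around_cell hleft).1
  | west x y =>
    rw [leftCell_west] at hleft ⊢
    rw [edgeDomino_comm, edgeDomino_east]
    simpa only [sub_add_cancel] using (hθ.step_around_cell hleft).2.2.1
  | north x y =>
    rw [leftCell_north] at hleft ⊢
    rw [edgeDomino_north]
    simpa only [sub_add_cancel] using (hθ.step_around_cell hleft).2.1
  | south x y =>
    rw [leftCell_south] at hleft ⊢
    rw [edgeDomino_comm, edgeDomino_north]
    exact (hθ.step_around_cell hleft).2.2.2

lemma step (hθ : IsHeightSection L t θ) {v w : Vertex} (h : (edgeGraph R).Adj v w) :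
    θ w = θ v + L.shift v w + colour (leftCell v w) * (1 - 4 * t.ind (edgeDomino v w)) := by
  rcases h.2 with hleft | hright
  · exact hθ.step_of_left h.1 hleft
  · have hstep := hθ.step_of_left h.1.symm hright
    rw [L.shift_symm _ _ h, edgeDomino_comm, colour_leftCell_swap h.1] at hstep
    linear_combination -hstep

end IsHeightSection

lemma subset_vertices : R ⊆ vertices R := fun c hc =>
  Finset.mem_biUnion.2 ⟨c, hc, by simp⟩

lemma exists_adj_of_mem_vertices {v : Vertex} (hv : v ∈ vertices R) :
    ∃ w, (edgeGraph R).Adj v w := by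
  simp only [vertices, Finset.mem_biUnion, Finset.mem_insert, Finset.mem_singleton] at hv
  obtain ⟨⟨x, y⟩, hc, hv⟩ := hv
  simp only [Prod.mk_add_mk, add_zero] at hv
  have hsouth : (edgeGraph R).Adj (x, y) (x + 1, y) :=
    ⟨gridGraph_adj_east x y, .inl (by rwa [leftCell_east])⟩
  have hnorth : (edgeGraph R).Adj (x, y + 1) (x + 1, y + 1) :=
    ⟨gridGraph_adj_east x (y + 1), .inr (by rwa [leftCell_west, add_sub_cancel_right])⟩
  rcases hv with rfl | rfl | rfl | rfl
  exacts [⟨_, hsouth⟩, ⟨_, hsouth.symm⟩, ⟨_, hnorth⟩, ⟨_, hnorth.symm⟩]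

lemma IsHeightSection.sub_eq {L : HeightBundle R} {t t' : Tiling R} {θ θ' : Vertex → ℤ}
    (hθ : IsHeightSection L t θ) (hθ' : IsHeightSection L t' θ') (hbd : SameBoundary t t')
    (hb : ∀ v, IsBoundaryVertex R v → θ v = θ' v) {v : Vertex} (hv : v ∈ vertices R) :
    θ v - θ' v = -4 * heightDiff t t' v := by
  have boundary {v : Vertex} (hv : v ∈ vertices R) (hint : ¬ IsInterior R v) :
      θ v - θ' v = -4 * heightDiff t t' v := by
    obtain ⟨w, hw⟩ := exists_adj_of_mem_vertices hv
    rw [hb v (isBoundaryVertex_of_adj hw hint), hbd v hint, sub_self, mul_zero]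
  obtain ⟨x, y⟩ := v
  induction x using west_induction R with
  | base x hx =>
    refine boundary hv fun hint => ?_
    have := hx _ hint.2.1
    dsimp only at this
    omega
  | step x ih =>
    by_cases hint : IsInterior R (x + 1, y)
    · have hc : (x, y) ∈ R := by simpa using hint.2.1
      have hadj : (edgeGraph R).Adj (x, y) (x + 1, y) :=
        ⟨gridGraph_adj_east x y, .inl (by rwa [leftCell_east])⟩
      linear_combination hθ.step hadj - hθ'.step hadj + 4 * heightDiff_step t t' hadj.1 +
        ih (subset_vertices hc)
    · exact boundary hv hint

lemma SameBoundary.dist_eq_sum_sections {t t' : Tiling R} (hbd : SameBoundary t t')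
    {L : HeightBundle R} {θ θ' : Vertex → ℤ} (hθ : IsHeightSection L t θ)
    (hθ' : IsHeightSection L t' θ') (hb : ∀ v, IsBoundaryVertex R v → θ v = θ' v) :
    ((flipGraph R).dist t t' : ℚ) = 1 / 4 * ∑ v ∈ vertices R, |(θ v : ℚ) - (θ' v : ℚ)| := by
  have hterm (v : Vertex) (hv : v ∈ vertices R) :
      |(θ v : ℚ) - (θ' v : ℚ)| = 4 * ((heightDiff t t' v).natAbs : ℚ) := by
    rw [← Int.cast_sub, hθ.sub_eq hθ' hbd hb hv, Nat.cast_natAbs]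
    push_cast
    rw [abs_mul]
    norm_num
  have hsum : ∑ v ∈ R, ((heightDiff t t' v).natAbs : ℚ) =
      ∑ v ∈ vertices R, ((heightDiff t t' v).natAbs : ℚ) :=
    Finset.sum_subset subset_vertices fun v _ hv => by
      rw [hbd v fun hint => hv hint.1, Int.natAbs_zero, Nat.cast_zero]
  rw [Finset.sum_congr rfl hterm, ← Finset.mul_sum, ← hsum, hbd.dist_eq, heightDist]
  push_cast
  ring

/-! ### Real height functions -/

/-- The admissible real heights `p` and `q` at the ends of an edge, for the domino crossing that
edge having indicator `a` in the reference tiling: the weight of the domino stays in `[0, 1]`, and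
at most one of the two heights is moving between integers. -/
def IsAdmissible (a : ℤ) (p q : ℝ) : Prop :=
  (a + (q - p) : ℝ) ∈ Set.Icc 0 1 ∧
    (p ∈ Set.range ((↑) : ℤ → ℝ) ∨ q ∈ Set.range ((↑) : ℤ → ℝ))

namespace IsAdmissible

variable {a : ℤ} {p q p' q' : ℝ}

lemma neg (h : IsAdmissible a p q) : IsAdmissible a (-q) (-p) := by
  obtain ⟨hweight, hint⟩ := h
  refine ⟨by rwa [neg_sub_neg], hint.symm.imp ?_ ?_⟩ <;>
  · rintro ⟨k, rfl⟩
    exact ⟨-k, Int.cast_neg k⟩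

lemma exchange (h : IsAdmissible a p q) (h' : IsAdmissible a p' q') (hp : p ≤ p')
    (hq : q' ≤ q) : IsAdmissible a p q' := by
  obtain ⟨⟨h0, h1⟩, hint⟩ := h
  obtain ⟨⟨h0', h1'⟩, hint'⟩ := h'
  refine ⟨⟨by linarith, by linarith⟩, ?_⟩
  by_contra! hmoving
  obtain ⟨hp_moving, hq'_moving⟩ := hmoving
  obtain ⟨k, rfl⟩ := hint.resolve_left hp_moving
  obtain ⟨m, rfl⟩ := hint'.resolve_right hq'_moving
  -- Strictness from non-integrality: `a + k - 1 < p ≤ m ≤ a + q' < a + k`.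
  have hp_lt : ((a + k - 1 : ℤ) : ℝ) < p :=
    lt_of_le_of_ne (by push_cast; linarith) fun e => hp_moving ⟨_, e⟩
  have hq'_lt : q' < k := lt_of_le_of_ne hq fun e => hq'_moving ⟨_, e.symm⟩
  have hlower : a + k - 1 < m := Int.cast_lt.1 (hp_lt.trans_le hp)
  have hupper : (m : ℝ) < ((a + k : ℤ) : ℝ) := by push_cast; linarith
  have := Int.cast_lt.1 hupper
  omega

lemma inf (h : IsAdmissible a p q) (h' : IsAdmissible a p' q') :
    IsAdmissible a (p ⊓ p') (q ⊓ q') := by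
  rcases le_total p p' with hp | hp <;> rcases le_total q q' with hq | hq <;>
    simp only [inf_of_le_left, inf_of_le_right, hp, hq]
  · exact h
  · exact h.exchange h' hp hq
  · exact h'.exchange h hp hq
  · exact h'

lemma sup (h : IsAdmissible a p q) (h' : IsAdmissible a p' q') :
    IsAdmissible a (p ⊔ p') (q ⊔ q') := by
  simpa [min_neg_neg] using (h.neg.inf h'.neg).neg

lemma round (h : IsAdmissible a p q) {k l : ℤ} (hk : k ∈ Set.Icc ⌊p⌋ ⌈p⌉)
    (hl : l ∈ Set.Icc ⌊q⌋ ⌈q⌉) : a + (l - k) = 0 ∨ a + (l - k) = 1 := by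
  obtain ⟨⟨h0, h1⟩, ⟨m, rfl⟩ | ⟨m, rfl⟩⟩ := h
  · rw [Int.floor_intCast, Int.ceil_intCast, Set.Icc_self, Set.mem_singleton_iff] at hk
    subst hk
    have hlower : k - a ≤ ⌊q⌋ := Int.le_floor.2 (by push_cast; linarith)
    have hupper : ⌈q⌉ ≤ k + 1 - a := Int.ceil_le.2 (by push_cast; linarith)
    have := hl.1
    have := hl.2
    omega
  · rw [Int.floor_intCast, Int.ceil_intCast, Set.Icc_self, Set.mem_singleton_iff] at hl
    subst hl
    have hlower : a + l - 1 ≤ ⌊p⌋ := Int.le_floor.2 (by push_cast; linarith)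
    have hupper : ⌈p⌉ ≤ a + l := Int.ceil_le.2 (by push_cast; linarith)
    have := hk.1
    have := hk.2
    omega

end IsAdmissible

lemma isAdmissible_intCast {a k l : ℤ} :
    IsAdmissible a k l ↔ a + (l - k) = 0 ∨ a + (l - k) = 1 := by
  refine ⟨fun h => h.round (by simp) (by simp), fun h => ⟨?_, .inl ⟨k, rfl⟩⟩⟩
  norm_cast
  rcases h with h | h <;> simp [h]

/-- The real height functions, relative to `t₀`, of the points of the complex in the component
of `t₀`. Each domino is seen from the side that has a black unit square on the left. -/
def realHeights (t₀ : Tiling R) : Set (Vertex → ℝ) :=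
  {h | VanishesOutside R h ∧ ∀ v w, gridGraph.Adj v w → colour (leftCell v w) = 1 →
    IsAdmissible (t₀.ind (edgeDomino v w)) (h v) (h w)}

lemma infClosed_realHeights (t₀ : Tiling R) : InfClosed (realHeights t₀) :=
  fun h hh k hk => ⟨fun v hv => by rw [Pi.inf_apply, hh.1 v hv, hk.1 v hv, inf_idem],
    fun v w hvw hb => (hh.2 v w hvw hb).inf (hk.2 v w hvw hb)⟩

lemma supClosed_realHeights (t₀ : Tiling R) : SupClosed (realHeights t₀) :=
  fun h hh k hk => ⟨fun v hv => by rw [Pi.sup_apply, hh.1 v hv, hk.1 v hv, sup_idem],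
    fun v w hvw hb => (hh.2 v w hvw hb).sup (hk.2 v w hvw hb)⟩

lemma round_mem_realHeights {t₀ : Tiling R} {h : Vertex → ℝ} (hh : h ∈ realHeights t₀)
    {n : Vertex → ℤ} (hn : ∀ v, n v ∈ Set.Icc ⌊h v⌋ ⌈h v⌉) :
    (fun v => (n v : ℝ)) ∈ realHeights t₀ := by
  refine ⟨fun v hv => ?_, fun v w hvw hb =>
    isAdmissible_intCast.2 ((hh.2 v w hvw hb).round (hn v) (hn w))⟩
  have := hn v
  rw [hh.1 v hv, Int.floor_zero, Int.ceil_zero, Set.Icc_self, Set.mem_singleton_iff] at this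
  simp [this]

lemma floor_mem_realHeights {t₀ : Tiling R} {h : Vertex → ℝ} (hh : h ∈ realHeights t₀) :
    (fun v => (⌊h v⌋ : ℝ)) ∈ realHeights t₀ :=
  round_mem_realHeights hh fun _ => ⟨le_rfl, Int.floor_le_ceil _⟩

lemma ceil_mem_realHeights {t₀ : Tiling R} {h : Vertex → ℝ} (hh : h ∈ realHeights t₀) :
    (fun v => (⌈h v⌉ : ℝ)) ∈ realHeights t₀ :=
  round_mem_realHeights hh fun _ => ⟨Int.floor_le_ceil _, le_rfl⟩

lemma IsDomino.exists_black_edge {d : Finset Cell} (hd : IsDomino d) :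
    ∃ v w, gridGraph.Adj v w ∧ colour (leftCell v w) = 1 ∧ edgeDomino v w = d := by
  obtain ⟨v, w, hvw, rfl⟩ := hd.exists_edge
  rcases colour_eq_or (leftCell v w) with hb | hb
  · exact ⟨v, w, hvw, hb, rfl⟩
  · exact ⟨w, v, hvw.symm, by rw [colour_leftCell_swap hvw, hb, neg_neg], edgeDomino_comm ..⟩

lemma heightDiff_mem_realHeights {t t₀ : Tiling R} (h : SameBoundary t t₀) :
    (fun v => (heightDiff t t₀ v : ℝ)) ∈ realHeights t₀ := by
  refine ⟨fun v hv => by simp [h v hv], fun v w hvw hb => ?_⟩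
  rw [isAdmissible_intCast, heightDiff_step t t₀ hvw, hb, one_mul, add_sub_cancel_left,
    add_sub_cancel]
  exact t.ind_eq_or _

lemma exists_tiling_of_mem_realHeights {t₀ : Tiling R} {n : Vertex → ℤ}
    (hn : (fun v => (n v : ℝ)) ∈ realHeights t₀) :
    ∃ t : Tiling R, SameBoundary t t₀ ∧ heightDiff t t₀ = n := by
  have hv : VanishesOutside R n := fun v hv => by simpa using hn.1 v hv
  have h01 : ∀ d, t₀.ind d + coboundary n d = 0 ∨ t₀.ind d + coboundary n d = 1 := by
    intro d
    by_cases hd : IsDomino d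
    · obtain ⟨v, w, hvw, hb, rfl⟩ := hd.exists_black_edge
      rw [coboundary_edgeDomino n hvw, hb, Int.cast_one, one_mul]
      exact isAdmissible_intCast.1 (hn.2 v w hvw hb)
    · rw [coboundary_eq_zero_of_not_isDomino _ hd, add_zero]
      exact t₀.ind_eq_or d
  obtain ⟨t, rfl⟩ := exists_tiling_of_height t₀ hv h01
  exact ⟨t, hv, rfl⟩

instance : Finite (Tiling R) := by
  refine Finite.of_injective (β := R.powerset.powerset)
    (fun t => ⟨t.dominoes, Finset.mem_powerset.2 fun d hd =>
      Finset.mem_powerset.2 (t.subset d hd)⟩) fun t t' h => ?_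
  exact Tiling.ext (congrArg Subtype.val h)

lemma exists_isGreatest_of_supClosed {α : Type*} [SemilatticeSup α] {s : Set α}
    (hs : SupClosed s) (hfin : s.Finite) (hne : s.Nonempty) : ∃ a, IsGreatest s a := by
  obtain ⟨a, ha⟩ := hfin.exists_maximal hne
  exact ⟨a, ha.1, hs.directedOn.is_top_of_is_max ha.1 fun _ hb hab => ha.2 hb hab⟩

lemma exists_isLeast_of_infClosed {α : Type*} [SemilatticeInf α] {s : Set α}
    (hs : InfClosed s) (hfin : s.Finite) (hne : s.Nonempty) : ∃ a, IsLeast s a :=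
  exists_isGreatest_of_supClosed (α := αᵒᵈ) hs hfin hne

/-- The integer-valued functions among `realHeights t₀`. -/
def integerHeights (t₀ : Tiling R) : Set (Vertex → ℤ) :=
  {n | (fun v => (n v : ℝ)) ∈ realHeights t₀}

lemma finite_integerHeights (t₀ : Tiling R) : (integerHeights t₀).Finite :=
  (Set.finite_range fun t => heightDiff t t₀).subset fun _ hn =>
    (exists_tiling_of_mem_realHeights hn).imp fun _ ht => ht.2

lemma nonempty_integerHeights (t₀ : Tiling R) : (integerHeights t₀).Nonempty :=
  ⟨_, heightDiff_mem_realHeights (SameBoundary.refl t₀)⟩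

lemma exists_isGreatest_realHeights (t₀ : Tiling R) :
    ∃ t, SameBoundary t t₀ ∧ IsGreatest (realHeights t₀) fun v => (heightDiff t t₀ v : ℝ) := by
  have hsup : SupClosed (integerHeights t₀) := fun m hm n hn => by
    simpa [integerHeights, Pi.sup_def] using supClosed_realHeights t₀ hm hn
  obtain ⟨n, hn, hmax⟩ :=
    exists_isGreatest_of_supClosed hsup (finite_integerHeights t₀) (nonempty_integerHeights t₀)
  obtain ⟨t, ht, rfl⟩ := exists_tiling_of_mem_realHeights hn
  exact ⟨t, ht, hn, fun h hh v =>
    (Int.le_ceil (h v)).trans (Int.cast_le.2 (hmax (ceil_mem_realHeights hh) v))⟩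

lemma exists_isLeast_realHeights (t₀ : Tiling R) :
    ∃ t, SameBoundary t t₀ ∧ IsLeast (realHeights t₀) fun v => (heightDiff t t₀ v : ℝ) := by
  have hinf : InfClosed (integerHeights t₀) := fun m hm n hn => by
    simpa [integerHeights, Pi.inf_def] using infClosed_realHeights t₀ hm hn
  obtain ⟨n, hn, hmin⟩ :=
    exists_isLeast_of_infClosed hinf (finite_integerHeights t₀) (nonempty_integerHeights t₀)
  obtain ⟨t, ht, rfl⟩ := exists_tiling_of_mem_realHeights hn
  exact ⟨t, ht, hn, fun h hh v =>
    (Int.cast_le.2 (hmin (floor_mem_realHeights hh) v)).trans (Int.floor_le (h v))⟩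

/-! ### Cubes of independent flips -/

lemma point_sub_point (t t' : Tiling R) :
    t.point - t'.point = fun d => (((t.ind - t'.ind) d : ℤ) : ℝ) := by
  funext d
  simp [Tiling.point_apply]

lemma point_sub_point_mem_circulations (t t' : Tiling R) :
    t.point - t'.point ∈ circulations R ℝ := by
  rw [point_sub_point]
  exact intCast_mem_circulations (ind_sub_ind_mem_circulations t t')

lemma potential_point_sub_point (t t' : Tiling R) (v : Vertex) :
    potential R (t.point - t'.point) v = heightDiff t t' v := by
  rw [point_sub_point, potential_intCast, heightDiff]

lemma cellMap_sub_point (t t₀ : Tiling R) (S : Finset (Tiling R)) (a : Tiling R → ℝ) :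
    cellMap t S a - t₀.point =
      (t.point - t₀.point) + ∑ t' ∈ S, a t' • (t'.point - t.point) :=
  add_sub_right_comm ..

lemma cellMap_sub_point_mem_circulations (t t₀ : Tiling R) (S : Finset (Tiling R))
    (a : Tiling R → ℝ) : cellMap t S a - t₀.point ∈ circulations R ℝ := by
  rw [cellMap_sub_point]
  exact add_mem (point_sub_point_mem_circulations t t₀)
    (sum_mem fun t' _ => Submodule.smul_mem _ _ (point_sub_point_mem_circulations t' t))

lemma potential_cellMap_sub_point (t t₀ : Tiling R) (S : Finset (Tiling R)) (a : Tiling R → ℝ)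
    (v : Vertex) : potential R (cellMap t S a - t₀.point) v =
      heightDiff t t₀ v + ∑ t' ∈ S, a t' * heightDiff t' t v := by
  rw [cellMap_sub_point, map_add, map_sum]
  simp only [map_smul, Pi.add_apply, Finset.sum_apply, Pi.smul_apply, smul_eq_mul,
    potential_point_sub_point]

lemma heightDiff_eq_zero_or_of_adj {t t' : Tiling R} (h : (flipGraph R).Adj t t') {v w : Vertex}
    (hvw : v ≠ w) : heightDiff t' t v = 0 ∨ heightDiff t' t w = 0 := by
  obtain ⟨u, -, hu | hu⟩ := flipGraph_adj_iff.1 h <;>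
  · rw [hu]
    by_cases hv : v = u
    · exact .inr (Pi.single_eq_of_ne (hv ▸ hvw.symm) _)
    · exact .inl (Pi.single_eq_of_ne hv _)

lemma SameBoundary.of_adj {t t' : Tiling R} (h : (flipGraph R).Adj t t') : SameBoundary t' t :=
  SameBoundary.of_reachable h.symm.reachable

lemma mem_flipSquare_of_ind_ne {t t' : Tiling R} {d : Finset Cell} {c : Cell} (hc : c ∈ d)
    (h : t.ind d ≠ t'.ind d) : c ∈ flipSquare t t' := by
  simp only [flipSquare, Finset.mem_biUnion, Finset.mem_sdiff, id]
  by_cases hd : d ∈ t.dominoes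
  · exact ⟨d, ⟨hd, fun hd' => h (by rw [Tiling.ind_eq_one.2 hd, Tiling.ind_eq_one.2 hd'])⟩, hc⟩
  · have hd' : d ∈ t'.dominoes := by
      by_contra hd'
      exact h (by rw [Tiling.ind_eq_zero.2 hd, Tiling.ind_eq_zero.2 hd'])
    obtain ⟨e, ⟨he, hce⟩, -⟩ := t.cover c (t'.subset d hd' hc)
    refine ⟨e, ⟨he, fun he' => hd ?_⟩, hce⟩
    rwa [t'.eq_of_mem hd' he' hc hce]

lemma leftCell_mem_flipSquare {t t' : Tiling R} (h : (flipGraph R).Adj t t') {v w : Vertex}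
    (hvw : gridGraph.Adj v w) (hmove : heightDiff t' t v ≠ 0 ∨ heightDiff t' t w ≠ 0) :
    leftCell v w ∈ flipSquare t t' := by
  refine mem_flipSquare_of_ind_ne (Finset.mem_insert_self _ {leftCell w v}) fun heq => ?_
  have hstep := heightDiff_step t' t hvw
  rw [show t.ind (edgeDomino v w) = t'.ind (edgeDomino v w) from heq, sub_self, mul_zero,
    add_zero] at hstep
  have := heightDiff_eq_zero_or_of_adj h hvw.ne
  grind

lemma IsAdmissible.interpolate {a k l m n : ℤ} {r : ℝ} (hr : r ∈ Set.Icc (0 : ℝ) 1)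
    (h : IsAdmissible a k l) (h' : IsAdmissible a (k + m : ℤ) (l + n : ℤ)) (hmn : m = 0 ∨ n = 0) :
    IsAdmissible a (k + r * m) (l + r * n) := by
  refine ⟨?_, hmn.imp ?_ ?_⟩
  · have hconvex := convex_Icc (0 : ℝ) 1 h.1 h'.1 (sub_nonneg.2 hr.2) hr.1 (sub_add_cancel 1 r)
    convert hconvex using 1
    push_cast
    simp only [smul_eq_mul]
    ring
  · rintro rfl
    exact ⟨k, by simp⟩
  · rintro rfl
    exact ⟨l, by simp⟩

lemma add_mul_heightDiff_mem_realHeights {t t' t₀ : Tiling R} (ht : SameBoundary t t₀)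
    (h : (flipGraph R).Adj t t') {r : ℝ} (hr : r ∈ Set.Icc (0 : ℝ) 1) :
    (fun v => (heightDiff t t₀ v + r * heightDiff t' t v : ℝ)) ∈ realHeights t₀ := by
  have ht' := SameBoundary.of_adj h
  refine ⟨fun v hv => by simp [ht v hv, ht' v hv], fun v w hvw hb => ?_⟩
  have hend := (heightDiff_mem_realHeights (ht'.trans ht)).2 v w hvw hb
  simp only [← heightDiff_add_apply t' t t₀, add_comm (heightDiff t' t _)] at hend
  exact ((heightDiff_mem_realHeights ht).2 v w hvw hb).interpolate hr hend
    (heightDiff_eq_zero_or_of_adj h hvw.ne)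

/-- Disjoint `2 × 2` squares cannot share the left unit square of an edge. -/
lemma IndependentFlips.eq_of_move {t : Tiling R} {S : Finset (Tiling R)}
    (hS : IndependentFlips t S) {v w : Vertex} (hvw : gridGraph.Adj v w) {t' t'' : Tiling R}
    (ht' : t' ∈ S) (ht'' : t'' ∈ S) (hmove' : heightDiff t' t v ≠ 0 ∨ heightDiff t' t w ≠ 0)
    (hmove'' : heightDiff t'' t v ≠ 0 ∨ heightDiff t'' t w ≠ 0) : t' = t'' := by
  by_contra hne
  exact Finset.disjoint_left.1 (hS.2 ht' ht'' hne)
    (leftCell_mem_flipSquare (hS.1 t' ht') hvw hmove')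
    (leftCell_mem_flipSquare (hS.1 t'' ht'') hvw hmove'')

lemma cellMap_mem_realHeights {t t₀ : Tiling R} (ht : SameBoundary t t₀) {S : Finset (Tiling R)}
    (hS : IndependentFlips t S) {a : Tiling R → ℝ} (ha : ∀ t', a t' ∈ Set.Icc (0 : ℝ) 1) :
    potential R (cellMap t S a - t₀.point) ∈ realHeights t₀ := by
  refine ⟨fun v hv => ?_, fun v w hvw hb => ?_⟩
  · rw [potential_cellMap_sub_point, ht v hv, Finset.sum_eq_zero, Int.cast_zero, add_zero]
    intro t' ht'
    rw [SameBoundary.of_adj (hS.1 t' ht') v hv, Int.cast_zero, mul_zero]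
  rw [potential_cellMap_sub_point, potential_cellMap_sub_point]
  by_cases hmove : ∃ t' ∈ S, heightDiff t' t v ≠ 0 ∨ heightDiff t' t w ≠ 0
  · obtain ⟨t', ht', hmove⟩ := hmove
    have hrest : ∀ s ∈ S, s ≠ t' → heightDiff s t v = 0 ∧ heightDiff s t w = 0 := by
      intro s hs hne
      by_contra! hmove'
      exact hne (hS.eq_of_move hvw hs ht' (by tauto) hmove)
    rw [Finset.sum_eq_single_of_mem t' ht' fun s hs hne => by simp [(hrest s hs hne).1],
      Finset.sum_eq_single_of_mem t' ht' fun s hs hne => by simp [(hrest s hs hne).2]]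
    exact (add_mul_heightDiff_mem_realHeights ht (hS.1 t' ht') (ha t')).2 v w hvw hb
  · push Not at hmove
    rw [Finset.sum_eq_zero fun s hs => by simp [(hmove s hs).1],
      Finset.sum_eq_zero fun s hs => by simp [(hmove s hs).2], add_zero, add_zero]
    exact (heightDiff_mem_realHeights ht).2 v w hvw hb

lemma fract_eq_zero_or_of_adj {t₀ : Tiling R} {h : Vertex → ℝ} (hh : h ∈ realHeights t₀)
    {v w : Vertex} (hvw : gridGraph.Adj v w) : Int.fract (h v) = 0 ∨ Int.fract (h w) = 0 := by
  simp only [Int.fract_eq_zero_iff]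
  rcases colour_eq_or (leftCell v w) with hb | hb
  · exact (hh.2 v w hvw hb).2
  · exact (hh.2 w v hvw.symm (by rw [colour_leftCell_swap hvw, hb, neg_neg])).2.symm

lemma eq_or_eq_of_heightDiff_eq_single {t t' : Tiling R} {u v w : Vertex} {k : ℤ}
    (h : heightDiff t' t = Pi.single u k) (hvw : gridGraph.Adj v w)
    (hd : t'.ind (edgeDomino v w) ≠ t.ind (edgeDomino v w)) : u = v ∨ u = w := by
  by_contra! hne
  have hzero := congrFun (coboundary_heightDiff t' t) (edgeDomino v w)
  rw [h, coboundary_edgeDomino _ hvw, Pi.single_eq_of_ne hne.1.symm,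
    Pi.single_eq_of_ne hne.2.symm, sub_self, mul_zero] at hzero
  exact hd (sub_eq_zero.1 hzero.symm)

lemma disjoint_flipSquare_of_not_adj {t s s' : Tiling R} {v w : Vertex} {k l : ℤ}
    (hs : heightDiff s t = Pi.single v k) (hs' : heightDiff s' t = Pi.single w l) (hne : v ≠ w)
    (hvw : ¬ gridGraph.Adj v w) : Disjoint (flipSquare t s) (flipSquare t s') := by
  rw [Finset.disjoint_left]
  intro c hc hc'
  simp only [flipSquare, Finset.mem_biUnion, Finset.mem_sdiff, id] at hc hc'
  obtain ⟨d, ⟨hdt, hds⟩, hcd⟩ := hc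
  obtain ⟨d', ⟨hdt', hds'⟩, hcd'⟩ := hc'
  obtain rfl : d = d' := t.eq_of_mem hdt hdt' hcd hcd'
  obtain ⟨p, q, hpq, rfl⟩ := (t.isDomino d hdt).exists_edge
  have hind : t.ind (edgeDomino p q) = 1 := Tiling.ind_eq_one.2 hdt
  have hv := eq_or_eq_of_heightDiff_eq_single hs hpq (by
    rw [hind, Tiling.ind_eq_zero.2 hds]; exact zero_ne_one)
  have hw := eq_or_eq_of_heightDiff_eq_single hs' hpq (by
    rw [hind, Tiling.ind_eq_zero.2 hds']; exact zero_ne_one)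
  have := hpq.symm
  rcases hv with rfl | rfl <;> rcases hw with rfl | rfl <;> tauto

lemma exists_flip_of_fract_ne_zero {t t₀ : Tiling R} {h : Vertex → ℝ} (hh : h ∈ realHeights t₀)
    (ht : heightDiff t t₀ = fun v => ⌊h v⌋) {v : Vertex} (hv : Int.fract (h v) ≠ 0) :
    ∃ s : Tiling R, heightDiff s t = Pi.single v 1 := by
  have hround : ∀ w, ((fun v => ⌊h v⌋) + Pi.single v 1 : Vertex → ℤ) w ∈
      Set.Icc ⌊h w⌋ ⌈h w⌉ := by
    intro w
    obtain rfl | hw := eq_or_ne w v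
    · have hceil : (⌈h w⌉ : ℤ) = ⌊h w⌋ + 1 := Int.ceil_eq_floor_add_one_iff_notMem _ |>.2
        (mt Int.fract_eq_zero_iff.2 hv)
      simp [hceil]
    · simpa [hw] using Int.floor_le_ceil (h w)
  obtain ⟨s, -, hs⟩ := exists_tiling_of_mem_realHeights (round_mem_realHeights hh hround)
  refine ⟨s, ?_⟩
  rw [← heightDiff_add s t t₀, ht, add_comm] at hs
  exact add_left_cancel hs

/-- The cube containing a real height function is spanned from its floor by the flips that raise
its non-integral heights, the coordinates being the fractional parts. -/
lemma exists_cell_of_mem_realHeights {t₀ : Tiling R} {h : Vertex → ℝ} (hh : h ∈ realHeights t₀) :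
    ∃ (t : Tiling R) (S : Finset (Tiling R)) (a : Tiling R → ℝ), IndependentFlips t S ∧
      (∀ t', a t' ∈ Set.Icc (0 : ℝ) 1) ∧ potential R (cellMap t S a - t₀.point) = h := by
  classical
  obtain ⟨t, -, hfloor⟩ := exists_tiling_of_mem_realHeights (floor_mem_realHeights hh)
  have hinterior {v : Vertex} (hv : Int.fract (h v) ≠ 0) : IsInterior R v := by
    by_contra hout
    exact hv (by rw [hh.1 v hout, Int.fract_zero])
  let V := {v ∈ R | Int.fract (h v) ≠ 0}
  have mem_V {v : Vertex} : v ∈ V ↔ Int.fract (h v) ≠ 0 :=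
    Finset.mem_filter.trans (and_iff_right_of_imp fun hv => (hinterior hv).1)
  have : Nonempty (Tiling R) := ⟨t⟩
  choose! f hf using fun v (hv : v ∈ V) => exists_flip_of_fract_ne_zero hh hfloor (mem_V.1 hv)
  have hinj : Set.InjOn f V := fun v hv w hw hvw => by
    have hsingle := hf v hv
    rw [hvw, hf w hw] at hsingle
    by_contra hne
    simpa [hne] using congrFun hsingle v
  refine ⟨t, V.image f, fun s => Int.fract (h (Function.invFunOn f V s)), ⟨?_, ?_⟩,
    fun s => ⟨Int.fract_nonneg _, (Int.fract_lt_one _).le⟩, ?_⟩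
  · simp only [Finset.forall_mem_image]
    exact fun v hv => flipGraph_adj_iff.2 ⟨v, hinterior (mem_V.1 hv), .inl (hf v hv)⟩
  · rw [Finset.coe_image, hinj.pairwise_image]
    intro v hv w hw hne
    refine disjoint_flipSquare_of_not_adj (hf v hv) (hf w hw) hne fun hvw => ?_
    exact (fract_eq_zero_or_of_adj hh hvw).elim (mem_V.1 hv) (mem_V.1 hw)
  · funext v
    have hcoord : ∀ w ∈ V, Int.fract (h (Function.invFunOn f V (f w))) *
        (heightDiff (f w) t v : ℝ) = if v = w then Int.fract (h w) else 0 := fun w hw => by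
      rw [hinj.leftInvOn_invFunOn hw, hf w hw, Pi.single_apply]
      split_ifs <;> simp
    rw [potential_cellMap_sub_point, Finset.sum_image hinj, hfloor, Finset.sum_congr rfl hcoord,
      Finset.sum_ite_eq, ite_eq_left_iff.2 fun hv => (not_not.1 (mt mem_V.2 hv)).symm]
    exact Int.floor_add_fract (h v)

/-! ### Contractibility -/

instance {ι : Type*} {L : ι → Type*} [∀ i, Min (L i)] [∀ i, TopologicalSpace (L i)]
    [∀ i, ContinuousInf (L i)] : ContinuousInf (∀ i, L i) where
  continuous_inf := continuous_pi fun i =>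
    ((continuous_apply i).comp continuous_fst).inf ((continuous_apply i).comp continuous_snd)

lemma contractibleSpace_of_infClosed {α : Type*} [SemilatticeInf α] [TopologicalSpace α]
    [ContinuousInf α] {s : Set α} (hs : InfClosed s) {a b : α} (ha : IsGreatest s a)
    (hb : IsLeast s b) (hab : JoinedIn s a b) : ContractibleSpace s := by
  obtain ⟨γ, hγ⟩ := hab
  rw [contractible_iff_id_nullhomotopic]
  exact ⟨⟨b, hb.1⟩, ⟨{
    toFun p := ⟨p.2 ⊓ γ p.1, hs p.2.2 (hγ p.1)⟩
    map_zero_left x := Subtype.ext (by simpa using ha.2 x.2)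
    map_one_left x := Subtype.ext (by simpa using hb.2 x.2) }⟩⟩

lemma joinedIn_realHeights_of_adj {t₀ t t' : Tiling R} (ht : SameBoundary t t₀)
    (h : (flipGraph R).Adj t t') :
    JoinedIn (realHeights t₀) (fun v => (heightDiff t t₀ v : ℝ))
      (fun v => (heightDiff t' t₀ v : ℝ)) := by
  refine JoinedIn.ofLine (f := fun r v => heightDiff t t₀ v + r * heightDiff t' t v)
    (by fun_prop) (by simp) ?_ ?_
  · funext v
    rw [one_mul, ← Int.cast_add, add_comm, heightDiff_add_apply]
  · rintro _ ⟨r, hr, rfl⟩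
    exact add_mul_heightDiff_mem_realHeights ht h hr

lemma joinedIn_realHeights {t₀ t t' : Tiling R} (ht : SameBoundary t t₀)
    (ht' : SameBoundary t' t₀) :
    JoinedIn (realHeights t₀) (fun v => (heightDiff t t₀ v : ℝ))
      (fun v => (heightDiff t' t₀ v : ℝ)) := by
  obtain ⟨p⟩ := reachable_iff_sameBoundary.2 (ht.trans ht'.symm)
  induction p with
  | nil => exact JoinedIn.refl (heightDiff_mem_realHeights ht)
  | cons h _ ih =>
    exact (joinedIn_realHeights_of_adj ht h).trans (ih ((SameBoundary.of_adj h).trans ht) ht')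

instance (t₀ : Tiling R) : ContractibleSpace (realHeights t₀) := by
  obtain ⟨t, ht, hmax⟩ := exists_isGreatest_realHeights t₀
  obtain ⟨t', ht', hmin⟩ := exists_isLeast_realHeights t₀
  exact contractibleSpace_of_infClosed (infClosed_realHeights t₀) hmax hmin
    (joinedIn_realHeights ht ht')

lemma continuous_potential : Continuous (potential R : (Finset Cell → ℝ) → Vertex → ℝ) := by
  refine continuous_pi fun v => ?_
  simp only [potential_apply]
  fun_prop

lemma continuous_coboundary : Continuous (coboundary : (Vertex → ℝ) → Finset Cell → ℝ) := by
  refine continuous_pi fun d => continuous_finsetSum _ fun c _ => ?_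
  split_ifs <;> fun_prop

lemma point_add_coboundary_potential (t₀ : Tiling R) {x : Finset Cell → ℝ}
    (hx : x ∈ flipComplex R) : t₀.point + coboundary (potential R (x - t₀.point)) = x := by
  obtain ⟨t, S, -, a, -, rfl⟩ := hx
  rw [coboundary_potential (cellMap_sub_point_mem_circulations t t₀ S a), add_sub_cancel]

lemma point_add_coboundary_mem_flipComplex {t₀ : Tiling R} {h : Vertex → ℝ}
    (hh : h ∈ realHeights t₀) : t₀.point + coboundary h ∈ flipComplex R := by
  obtain ⟨t, S, a, hS, ha, rfl⟩ := exists_cell_of_mem_realHeights hh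
  have hx : cellMap t S a ∈ flipComplex R := ⟨t, S, hS, a, ha, rfl⟩
  rwa [point_add_coboundary_potential t₀ hx]

lemma potential_point_add_coboundary {t₀ : Tiling R} {h : Vertex → ℝ} (hh : h ∈ realHeights t₀) :
    potential R (t₀.point + coboundary h - t₀.point) = h := by
  rw [add_sub_cancel_left, hh.1.potential_coboundary]

lemma potential_cellMap_of_not_isInterior {t : Tiling R} (t₀ : Tiling R) {S : Finset (Tiling R)}
    (hS : IndependentFlips t S) (a : Tiling R → ℝ) {v : Vertex} (hv : ¬ IsInterior R v) :
    potential R (cellMap t S a - t₀.point) v = heightDiff t t₀ v := by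
  rw [potential_cellMap_sub_point, Finset.sum_eq_zero, add_zero]
  intro t' ht'
  rw [SameBoundary.of_adj (hS.1 t' ht') v hv, Int.cast_zero, mul_zero]

/-- The points of the complex whose heights relative to `t₀` vanish off the interior of `R`; this
is the component of `t₀`, see `connectedComponent_eq`. -/
def boundarySlice (t₀ : Tiling R) : Set (flipComplex R) :=
  {x | VanishesOutside R (potential R (x.1 - t₀.point))}

lemma potential_mem_realHeights {t₀ : Tiling R} {x : flipComplex R} (hx : x ∈ boundarySlice t₀) :
    potential R (x.1 - t₀.point) ∈ realHeights t₀ := by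
  obtain ⟨_, t, S, hS, a, ha, rfl⟩ := x
  have ht : SameBoundary t t₀ := fun v hv => by
    have := hx v hv
    rwa [potential_cellMap_of_not_isInterior t₀ hS a hv, Int.cast_eq_zero] at this
  exact cellMap_mem_realHeights ht hS ha

/-- A point of the component of `t₀` in the complex is determined by its height function. -/
noncomputable def realHeightsHomeomorph (t₀ : Tiling R) : realHeights t₀ ≃ₜ boundarySlice t₀ where
  toFun h := ⟨⟨t₀.point + coboundary h.1, point_add_coboundary_mem_flipComplex h.2⟩, by
    change VanishesOutside R _
    rw [potential_point_add_coboundary h.2]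
    exact h.2.1⟩
  invFun x := ⟨potential R (x.1.1 - t₀.point), potential_mem_realHeights x.2⟩
  left_inv h := Subtype.ext (potential_point_add_coboundary h.2)
  right_inv x := Subtype.ext (Subtype.ext (point_add_coboundary_potential t₀ x.1.2))
  continuous_toFun := by
    have := continuous_coboundary
    fun_prop
  continuous_invFun := by
    have := continuous_potential (R := R)
    fun_prop

instance (t₀ : Tiling R) : ContractibleSpace (boundarySlice t₀) :=
  (realHeightsHomeomorph t₀).symm.contractibleSpace

lemma potential_eq_of_mem_connectedComponent (t₀ : Tiling R) {x y : flipComplex R}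
    (hy : y ∈ connectedComponent x) {v : Vertex} (hv : ¬ IsInterior R v) :
    potential R (y.1 - t₀.point) v = potential R (x.1 - t₀.point) v := by
  have hcont : Continuous fun z : flipComplex R => potential R (z.1 - t₀.point) v := by
    have := continuous_potential (R := R)
    fun_prop
  have hdisc : IsDiscrete (Set.range ((↑) : ℤ → ℝ)) :=
    Int.isClosedEmbedding_coe_real.isInducing.isDiscrete_range
  refine isPreconnected_connectedComponent.constant_of_mapsTo hdisc hcont.continuousOn ?_ hy
    mem_connectedComponent
  rintro ⟨_, t, S, hS, a, -, rfl⟩ -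
  exact ⟨heightDiff t t₀ v, (potential_cellMap_of_not_isInterior t₀ hS a hv).symm⟩

lemma connectedComponent_eq {t₀ : Tiling R} {x : flipComplex R} (hx : x ∈ boundarySlice t₀) :
    connectedComponent x = boundarySlice t₀ := by
  refine Set.Subset.antisymm (fun y hy v hv => ?_) ?_
  · rw [potential_eq_of_mem_connectedComponent t₀ hy hv, hx v hv]
  · exact (isPreconnected_iff_preconnectedSpace.2 inferInstance).subset_connectedComponent hx

lemma contractibleSpace_connectedComponent (x : flipComplex R) :
    ContractibleSpace (connectedComponent x) := by
  obtain ⟨t, hx⟩ : ∃ t : Tiling R, x ∈ boundarySlice t := by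
    obtain ⟨_, t, S, hS, a, -, rfl⟩ := x
    exact ⟨t, fun v hv => by
      rw [potential_cellMap_of_not_isInterior t hS a hv, heightDiff_self, Pi.zero_apply,
        Int.cast_zero]⟩
  rw [connectedComponent_eq hx]
  infer_instance

end DominoFlip

theorem theorem3p4 (R : Finset Cell) :
    -- same component of the flip graph iff same flow across all cuts
    (∀ t₁ t₂ : Tiling R, (flipGraph R).Reachable t₁ t₂ ↔
      ∀ (u v : Vertex) (p : (edgeGraph R).Walk u v), IsCut p → t₁.flow p = t₂.flow p) ∧
    -- all tilings have height sections in one bundle, equal on the boundary within a component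
    (∃ (L : HeightBundle R) (θ : Tiling R → Vertex → ℤ),
      (∀ t, IsHeightSection L t (θ t)) ∧
      ∀ t₁ t₂, (flipGraph R).Reachable t₁ t₂ → ∀ v, IsBoundaryVertex R v → θ t₁ v = θ t₂ v) ∧
    -- the distance formula
    (∀ t₁ t₂ : Tiling R, (flipGraph R).Reachable t₁ t₂ →
      ∀ (L : HeightBundle R) (θ₁ θ₂ : Vertex → ℤ),
        IsHeightSection L t₁ θ₁ → IsHeightSection L t₂ θ₂ →
        (∀ v, IsBoundaryVertex R v → θ₁ v = θ₂ v) →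
        ((flipGraph R).dist t₁ t₂ : ℚ) =
          1 / 4 * ∑ v ∈ vertices R, |(θ₁ v : ℚ) - (θ₂ v : ℚ)|) ∧
    -- the connected components of the complex are contractible
    (∀ x : flipComplex R, ContractibleSpace (connectedComponent x)) := by
  exact ⟨fun t₁ t₂ => reachable_iff_sameBoundary.trans sameBoundary_iff_flow_eq,
    exists_bundle_sections R,
    fun t₁ t₂ h L θ₁ θ₂ h₁ h₂ hb =>
      (reachable_iff_sameBoundary.1 h).dist_eq_sum_sections h₁ h₂ hb,
    contractibleSpace_connectedComponent⟩
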